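/- Let $1\le N\le\infty$, $E=\{n\in\mathbb Z_{\ge 0}: n\le N\}$ and $\tilde E=\{n\in\mathbb Z_{\ge 0}: n<N\}$. Let $\lambda_n>0$ for $n\in\tilde E$, $\mu_0=0$ and $\mu_n>0$ for $n\in E$, $n\ge1$. If $N=\infty$, assume that the limits $\lambda=\lim_n\lambda_n>0$ and $\mu=\lim_n\mu_n>0$ exist; if $N<\infty$, put $\lambda_N=0$, $\lambda=\lambda_{N-1}$, $\mu=\mu_N$. Put $\lambda_{-1}=0$. Let $a,b:[0,\infty)\to[0,\infty)$ be locally integrable and asymptotically periodic: $a=a_1+a_2$, $b=b_1+b_2$, where $a_1(t+T_1)=a_1(t)$, $b_1(t+T_2)=b_1(t)$ for $t\ge0$ with $T_1,T_2>0$, and $a_2(t),b_2(t)\to0$ as $t\to\infty$. Put $a_m=\frac1{T_1}\int_0^{T_1}a_1$, $b_m=\frac1{T_2}\int_0^{T_2}b_1$. Consider the birth and death process on $E$ with birth rates $\lambda_n(t)=\lambda_na(t)$ and death rates $\mu_n(t)=\mu_nb(t)$. For $s\ge0$, a probability solution on $[s,\infty)$ is a function $p$ from $[s,\infty)$ to the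 probability vectors on $E$ which solves the forward Kolmogorov system $$p_i'(t)=\lambda_{i-1}(t)p_{i-1}(t)-(\lambda_i(t)+\mu_i(t))p_i(t)+\mu_{i+1}(t)p_{i+1}(t),\qquad i\in E,$$ in the integrated (Carathéodory) sense, with the terms whose index lies outside $E$ omitted. Assume that for some $\Delta>1$: (a) $\lambda_{k-1}\mu_{k+1}-\lambda_k\mu_k\ge0$ for all $k\in\tilde E$; (b) $\mu b_m-\Delta\lambda a_m>0$; (c) $f:=\inf_{k\in\tilde E}f_k>0$, where $$f_k=\frac{\Delta\lambda\mu_{k+1}-\lambda_{k-1}\mu+\sqrt{(\Delta\lambda\mu_{k+1}-\lambda_{k-1}\mu)^2+4\Delta\lambda\mu(\lambda_{k-1}\mu_{k+1}-\lambda_k\mu_k)}}{2\Delta\lambda\mu}.$$ Let $c\in(0,1)$ satisfy $c<\mu_{k+1}/\mu$ for all $k\in\tilde E$ and $c\le f$, and put $l(t)=c(\mu b(t)-\Delta\lambda a(t))$ and $l=c(\mu b_m-\Delta\lambda a_m)$. Then the process is exponentially weakly ergodic, in the following sense. First, $l>0$, and $\|p^{(1)}(t)-p^{(2)}(t)\|_{\ell_1}\to0$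 as $t\to\infty$ for any two probability solutions on $[0,\infty)$. Second, there is a sequence $\delta_k>0$ ($k\in\tilde E$), with $\liminf_k\delta_k>1$ if $N=\infty$, such that $$\lambda_k(t)+\mu_{k+1}(t)-\delta_{k+1}\lambda_{k+1}(t)-\delta_k^{-1}\mu_k(t)\ge l(t)\qquad(k\in\tilde E,\ t\ge0)$$ (if $N<\infty$, the term containing $\lambda_N=0$ is $0$), and the following holds. Put $d_k=\delta_1\cdots\delta_k$ for $k\in\tilde E$ (so $d_0=1$), $q_i=\sum_{m=0}^{i-1}d_m$, $g=\inf_{k\in\tilde E}d_k$ and $\|x\|_{1D}=\sum_{k\in\tilde E}d_k\bigl|\sum_{i>k}x_i\bigr|$. Then $g>0$, and for every $\varepsilon>0$ there is a constant $K$ such that, for all $0\le s\le t$, $$\exp\Bigl(-\int_s^tl(u)\,du\Bigr)\le Ke^{-(l-\varepsilon)(t-s)},$$ and, for any two probability solutions $p^{(1)},p^{(2)}$ on $[s,\infty)$, $$\|p^{(1)}(t)-p^{(2)}(t)\|_{1D}\le Ke^{-(l-\varepsilon)(t-s)}\|p^{(1)}(s)-p^{(2)}(s)\|_{1D},$$ $$\|p^{(1)}(t)-p^{(2)}(t)\|_{\ell_1}\le\frac{4K}{g}e^{-(l-\varepsilon)(t-s)}\sum_{i\ge1}q_i\bigl|p_i^{(1)}(s)-p_i^{(2)}(s)\bigr|,$$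 where the right-hand sides may be infinite. -/

import Mathlib

open Filter Topology MeasureTheory Set
open scoped ENNReal

noncomputable section

namespace BDP

/-- `g` is a nonnegative, locally integrable function on `[0, ∞)` which is asymptotically periodic
with period `T`: `g = g₁ + g₂` with `g₁` periodic and `g₂` vanishing at infinity. -/
structure AsymptoticallyPeriodic (g g₁ g₂ : ℝ → ℝ) (T : ℝ) : Prop where
  period_pos : 0 < T
  nonneg : ∀ t, 0 ≤ t → 0 ≤ g t
  locallyIntegrable : LocallyIntegrableOn g (Ici 0) volume
  decomp : ∀ t, 0 ≤ t → g t = g₁ t + g₂ t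
  periodic : ∀ t, 0 ≤ t → g₁ (t + T) = g₁ t
  vanish : Tendsto g₂ atTop (𝓝 0)

/-- Mean over one period. -/
def periodMean (g₁ : ℝ → ℝ) (T : ℝ) : ℝ := (1 / T) * ∫ u in (0 : ℝ)..T, g₁ u

/-- The basic birth rates `lam n` and death rates `mu n` on the state space
`{n : ℕ | n ≤ N}`, `1 ≤ N ≤ ∞`.  The numbers `L` and `M` are the limits of the rates if `N = ∞`,
and `lam (N - 1)` and `mu N` if `N < ∞`.  Values at `n > N` play no role. -/
structure Rates (N : ℕ∞) (lam mu : ℕ → ℝ) (L M : ℝ) : Prop where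
  one_le : 1 ≤ N
  lam_pos : ∀ n : ℕ, (n : ℕ∞) < N → 0 < lam n
  mu_zero : mu 0 = 0
  mu_pos : ∀ n : ℕ, 1 ≤ n → (n : ℕ∞) ≤ N → 0 < mu n
  infinite : N = ⊤ →
    Tendsto lam atTop (𝓝 L) ∧ 0 < L ∧ Tendsto mu atTop (𝓝 M) ∧ 0 < M
  finite : ∀ n : ℕ, N = ((n + 1 : ℕ) : ℕ∞) → lam (n + 1) = 0 ∧ L = lam n ∧ M = mu (n + 1)

/-- `prev x k = x (k - 1)`, with the convention `x (-1) = 0`. -/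
def prev (x : ℕ → ℝ) : ℕ → ℝ
  | 0 => 0
  | k + 1 => x k

/-- Probability vectors on `{n : ℕ | n ≤ N}`, extended by zero to `ℕ`. -/
def probVectors (N : ℕ∞) : Set (ℕ → ℝ) :=
  {x | (∀ n, 0 ≤ x n) ∧ (∀ n : ℕ, N < (n : ℕ∞) → x n = 0) ∧ HasSum x 1}

/-- The `i`-th coordinate of `A(t) x`, where `A(t)` is the (transposed) intensity matrix of the
birth and death process with birth rates `lam n * a t` and death rates `mu n * b t`. -/
def generator (lam mu : ℕ → ℝ) (a b : ℝ → ℝ) (t : ℝ) (x : ℕ → ℝ) (i : ℕ) : ℝ :=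
  prev lam i * a t * prev x i - (lam i * a t + mu i * b t) * x i
    + mu (i + 1) * b t * x (i + 1)

/-- `p` is, on `[s, ∞)`, a solution with values in the probability vectors of the forward
Kolmogorov system `dp/dt = A(t) p`.  As the coefficients are only locally integrable, the system
is understood in the integrated (Carathéodory) sense. -/
structure IsForwardSolution (N : ℕ∞) (lam mu : ℕ → ℝ) (a b : ℝ → ℝ) (s : ℝ)
    (p : ℝ → ℕ → ℝ) : Prop where
  mem : ∀ t, s ≤ t → p t ∈ probVectors N
  cont : ∀ i, ContinuousOn (fun t => p t i) (Ici s)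
  eq : ∀ t, s ≤ t → ∀ i : ℕ, (i : ℕ∞) ≤ N →
    p t i = p s i + ∫ u in s..t, generator lam mu a b u (p u) i

/-- The `ℓ₁` norm. -/
def norm1 (x : ℕ → ℝ) : ℝ≥0∞ := ∑' i, ENNReal.ofReal |x i|

/-- Weak ergodicity: any two probability solutions merge in `ℓ₁`. -/
def WeaklyErgodic (N : ℕ∞) (lam mu : ℕ → ℝ) (a b : ℝ → ℝ) : Prop :=
  ∀ p₁ p₂ : ℝ → ℕ → ℝ, IsForwardSolution N lam mu a b 0 p₁ →
    IsForwardSolution N lam mu a b 0 p₂ →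
    Tendsto (fun t => norm1 (p₁ t - p₂ t)) atTop (𝓝 0)

/-- The weights `d_k = δ_1 ⋯ δ_k` for `0 ≤ k < N` (so `d_0 = 1`), and `d_k = 0` for `k ≥ N`. -/
def weight (N : ℕ∞) (δ : ℕ → ℝ) (k : ℕ) : ℝ :=
  if (k : ℕ∞) < N then ∏ i ∈ Finset.range k, δ (i + 1) else 0

/-- `g = inf_{0 ≤ k < N} d_k`. -/
def weightInf (N : ℕ∞) (δ : ℕ → ℝ) : ℝ := sInf (weight N δ '' {k : ℕ | (k : ℕ∞) < N})

/-- `q_i = d_0 + ⋯ + d_{i-1}`. -/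
def weightSum (N : ℕ∞) (δ : ℕ → ℝ) (i : ℕ) : ℝ := ∑ m ∈ Finset.range i, weight N δ m

/-- The norm `‖x‖_{1D} = ‖D z‖_1`, where `z = (x_1, x_2, …)` and `D` is the upper triangular matrix
whose `k`-th row is `(0, …, 0, d_k, d_k, …)`; thus `(D z)_k = d_k * ∑_{i > k} x_i`. -/
def norm1D (N : ℕ∞) (δ : ℕ → ℝ) (x : ℕ → ℝ) : ℝ≥0∞ :=
  norm1 fun k => weight N δ k * ∑' i, x (k + 1 + i)

/-- The weighted sum `∑_{i ≥ 1} q_i |x_i|` (note that `q_0 = 0`). -/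
def normQ (N : ℕ∞) (δ : ℕ → ℝ) (x : ℕ → ℝ) : ℝ≥0∞ :=
  ∑' i, ENNReal.ofReal (weightSum N δ i * |x i|)

/-- `α_k(t) = λ_k(t) + μ_{k+1}(t) - δ_{k+1} λ_{k+1}(t) - δ_k⁻¹ μ_k(t)`; for `k = 0` the last term
vanishes because `μ_0 = 0`. -/
def alpha (lam mu : ℕ → ℝ) (a b : ℝ → ℝ) (δ : ℕ → ℝ) (k : ℕ) (t : ℝ) : ℝ :=
  lam k * a t + mu (k + 1) * b t - δ (k + 1) * (lam (k + 1) * a t) - (δ k)⁻¹ * (mu k * b t)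

/-- The numbers `f_k`. -/
def f (lam mu : ℕ → ℝ) (L M Δ : ℝ) (k : ℕ) : ℝ :=
  (Δ * L * mu (k + 1) - prev lam k * M
      + √((Δ * L * mu (k + 1) - prev lam k * M) ^ 2
          + 4 * Δ * L * M * (prev lam k * mu (k + 1) - lam k * mu k)))
    / (2 * Δ * L * M)

/-- `inf_{0 ≤ k < N} f_k`. -/
def fInf (N : ℕ∞) (lam mu : ℕ → ℝ) (L M Δ : ℝ) : ℝ :=
  sInf (f lam mu L M Δ '' {k : ℕ | (k : ℕ∞) < N})

/-- Uniform exponential merging of probability solutions at rate `r` with constant `K`, relative to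
the weights given by `δ`, from every starting time `s ≥ 0`, both in the norm `‖·‖_{1D}` and in the
`ℓ₁` norm.  Right-hand sides may be infinite. -/
def ExponentialMerging (N : ℕ∞) (lam mu : ℕ → ℝ) (a b : ℝ → ℝ) (δ : ℕ → ℝ) (K r : ℝ) : Prop :=
  ∀ s t : ℝ, 0 ≤ s → s ≤ t → ∀ p₁ p₂ : ℝ → ℕ → ℝ,
    IsForwardSolution N lam mu a b s p₁ → IsForwardSolution N lam mu a b s p₂ →
    norm1D N δ (p₁ t - p₂ t)
        ≤ ENNReal.ofReal (K * Real.exp (-r * (t - s))) * norm1D N δ (p₁ s - p₂ s) ∧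
    norm1 (p₁ t - p₂ t)
        ≤ ENNReal.ofReal (4 / weightInf N δ * (K * Real.exp (-r * (t - s))))
          * normQ N δ (p₁ s - p₂ s)

end BDP

end

/-! For a probability solution the tails u_k = ∑_{i>k} p_i satisfy u_k' = λ_k a (u_{k-1} - u_k) -
μ_{k+1} b (u_k - u_{k+1}), a cooperative nearest-neighbour system. Here u_{-1} is the total mass η:
it is 1 for a single solution and 0 for a difference of two. For η = 0, multiplying row k by d_k
sign(u_k) and summing by columns gives S' ≤ -β S for S = ∑ d_k |u_k|, as soon as every α_k ≥ β
(`sum_mul_le_of_cooperative`, `IsTailSolution.excessSum_mul_exp_le`).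

The ratios are chosen by δ_{k+1} λ_{k+1} = λ_k + cΔL. This makes the birth part of α_k equal to -cΔL
a(t). The death part is at least cM b(t) exactly when c satisfies a quadratic inequality whose
larger root is f_k; hence α_k ≥ l(t) (`Rates.le_alpha`). If N = ∞, then δ_k → 1 + cΔ > 1 and the
weights tend to infinity. Asymptotic periodicity turns exp(-∫ l) into K e^{-(l-ε)(t-s)}
(`AsymptoticallyPeriodic.abs_integral_sub_le`).

On an infinite state space two points need care. A truncated sum has an incoming boundary flux:
auxiliary weights tending to zero first show that finiteness of S persists, and then the
time-integrated flux is a term of a convergent series. Moreover S may be infinite at time 0, whereas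
weak ergodicity concerns all solutions. Therefore |u_k| is replaced by its excess (|u_k| - κ)⁺,
which obeys the same inequality and is nonzero initially for finitely many k only. For a difference
the excess decays, so the tails become uniformly small. For a single solution the source λ_0 a(t)
keeps the excess sum bounded, and since d_k → ∞ this gives tightness uniform in time. Together these
yield ℓ₁ merging (`Admissible.weaklyErgodic_of_top`). -/

namespace BDP

/-! ### Absolutely continuous functions -/

/-- Transfers absolute continuity through Lipschitz maps, here the exponential on a bounded range
and the excess, and from a primitive to a function with the same increments. -/
theorem absolutelyContinuousOnInterval_of_dist_le {f g : ℝ → ℝ} {s t C : ℝ}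
    (hg : AbsolutelyContinuousOnInterval g s t)
    (h : ∀ x ∈ uIcc s t, ∀ y ∈ uIcc s t, dist (f x) (f y) ≤ C * dist (g x) (g y)) :
    AbsolutelyContinuousOnInterval f s t := by
  have hg' : Tendsto (fun E : ℕ × (ℕ → ℝ × ℝ) =>
      C * ∑ i ∈ Finset.range E.1, dist (g (E.2 i).1) (g (E.2 i).2))
      (AbsolutelyContinuousOnInterval.totalLengthFilter ⊓
        𝓟 (AbsolutelyContinuousOnInterval.disjWithin s t)) (𝓝 0) := by
    simpa using Tendsto.const_mul C hg
  refine squeeze_zero' (Eventually.of_forall fun E =>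
    Finset.sum_nonneg fun i _ => dist_nonneg) ?_ hg'
  filter_upwards [mem_inf_of_right (mem_principal_self _)] with E hE
  rw [Finset.mul_sum]
  exact Finset.sum_le_sum fun i hi => h _ (hE.1 i hi).1 _ (hE.1 i hi).2

theorem AbsolutelyContinuousOnInterval.exp {g : ℝ → ℝ} {s t : ℝ}
    (hg : AbsolutelyContinuousOnInterval g s t) :
    AbsolutelyContinuousOnInterval (fun x => Real.exp (g x)) s t := by
  obtain ⟨C, hC⟩ := hg.exists_bound
  refine absolutelyContinuousOnInterval_of_dist_le (C := Real.exp C) hg fun x hx y hy => ?_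
  have := (convex_Icc (-C) C).norm_image_sub_le_of_norm_deriv_le (f := Real.exp)
    (C := Real.exp C) (fun z _ => Real.differentiableAt_exp) (fun z hz => ?_)
    (abs_le.1 (hC y hy)) (abs_le.1 (hC x hx))
  · simpa [Real.dist_eq] using this
  · rw [Real.deriv_exp, Real.norm_eq_abs, Real.abs_exp]
    exact Real.exp_le_exp.2 hz.2

theorem AbsolutelyContinuousOnInterval.fun_sum {ι : Type*} {S : Finset ι} {f : ι → ℝ → ℝ}
    {s t : ℝ} (hf : ∀ i ∈ S, AbsolutelyContinuousOnInterval (f i) s t) :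
    AbsolutelyContinuousOnInterval (fun x => ∑ i ∈ S, f i x) s t := by
  classical
  induction S using Finset.induction_on with
  | empty =>
    have : LipschitzOnWith 0 (fun _ : ℝ => (0 : ℝ)) (uIcc s t) :=
      (LipschitzWith.const (0 : ℝ)).lipschitzOnWith
    simpa using this.absolutelyContinuousOnInterval
  | insert i S hi ih =>
    simp only [Finset.sum_insert hi]
    exact (hf i (Finset.mem_insert_self i S)).fun_add
      (ih fun j hj => hf j (Finset.mem_insert_of_mem hj))

/-- A Gronwall inequality for absolutely continuous functions. -/
theorem AbsolutelyContinuousOnInterval.mul_exp_integral_le {S β h : ℝ → ℝ} {s t : ℝ} (hst : s ≤ t)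
    (hS : AbsolutelyContinuousOnInterval S s t) (hβ : IntervalIntegrable β volume s t)
    (hh : IntervalIntegrable h volume s t)
    (hd : ∀ᵐ r, r ∈ Ioo s t → deriv S r ≤ -(β r) * S r + h r) :
    S t * Real.exp (∫ r in s..t, β r) ≤
      S s + ∫ r in s..t, Real.exp (∫ q in s..r, β q) * h r := by
  have hG := hβ.absolutelyContinuousOnInterval_intervalIntegral (c := s) left_mem_uIcc
  have hE := AbsolutelyContinuousOnInterval.exp hG
  have hF := hS.fun_mul hE
  -- Fundamental theorem of calculus for `S` times the integrating factor; the product rule and `hd`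
  -- bound its derivative almost everywhere.
  have key := hF.integral_deriv_eq_sub
  simp only [intervalIntegral.integral_same, Real.exp_zero, mul_one] at key
  have hle : ∫ r in s..t, deriv (fun x => S x * Real.exp (∫ q in s..x, β q)) r ≤
      ∫ r in s..t, Real.exp (∫ q in s..r, β q) * h r := by
    refine intervalIntegral.integral_mono_ae_restrict hst hF.intervalIntegrable_deriv
      (hh.continuousOn_mul hE.continuousOn) ?_
    have h1 : ∀ᵐ r : ℝ, r ≠ s := by simp [ae_iff, measure_singleton]
    have h2 : ∀ᵐ r : ℝ, r ≠ t := by simp [ae_iff, measure_singleton]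
    refine (ae_restrict_iff' measurableSet_Icc).2 ?_
    filter_upwards [h1, h2, hd, hS.ae_differentiableAt, hβ.ae_hasDerivAt_integral]
      with r hr1 hr2 hr3 hr4 hr5 hr
    have hu : r ∈ uIcc s t := by rwa [uIcc_of_le hst]
    have hI : r ∈ Ioo s t := ⟨lt_of_le_of_ne hr.1 hr1.symm, lt_of_le_of_ne hr.2 hr2⟩
    have hdE := (hr5 hu s left_mem_uIcc).exp
    rw [((hr4 hu).hasDerivAt.fun_mul hdE).deriv]
    have := mul_le_mul_of_nonneg_right (hr3 hI) (Real.exp_pos (∫ q in s..r, β q)).le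
    nlinarith
  linarith

/-! ### The system for the tails -/

/-- `pre η x k = x (k - 1)`, with the convention `x (-1) = η`. -/
def pre (η : ℝ) (x : ℕ → ℝ) : ℕ → ℝ
  | 0 => η
  | k + 1 => x k

/-- The `k`-th coordinate of the vector field governing the tails `u k = ∑_{i > k} x i` of a
vector `x` of total mass `η` which moves along the forward equation. -/
def tailGenerator (lam mu : ℕ → ℝ) (a b : ℝ → ℝ) (η t : ℝ) (u : ℕ → ℝ) (k : ℕ) : ℝ :=
  lam k * a t * (pre η u k - u k) - mu (k + 1) * b t * (u k - u (k + 1))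

/-- `u` is a solution, bounded by `1`, of the system for the tails on `[s, ∞)`. -/
structure IsTailSolution (N : ℕ∞) (lam mu : ℕ → ℝ) (a b : ℝ → ℝ) (η s : ℝ)
    (u : ℝ → ℕ → ℝ) : Prop where
  cont : ∀ k, ContinuousOn (fun t => u t k) (Ici s)
  eq : ∀ t, s ≤ t → ∀ k : ℕ, (k : ℕ∞) < N →
    u t k = u s k + ∫ r in s..t, tailGenerator lam mu a b η r (u r) k
  abs_le : ∀ t, s ≤ t → ∀ k, |u t k| ≤ 1
  eq_zero : ∀ t, s ≤ t → ∀ k : ℕ, N ≤ k → u t k = 0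

/-! ### Excesses over a level and the weighted differential inequality -/

/-- The amount by which `|y|` exceeds `κ`. -/
def excess (κ y : ℝ) : ℝ := max (|y| - κ) 0

theorem excess_nonneg (κ y : ℝ) : 0 ≤ excess κ y := le_max_right _ _

theorem abs_le_excess_add (κ y : ℝ) : |y| ≤ excess κ y + κ := by
  have := le_max_left (|y| - κ) 0
  unfold excess; linarith

theorem excess_le_abs {κ : ℝ} (hκ : 0 ≤ κ) (y : ℝ) : excess κ y ≤ |y| :=
  max_le (by linarith) (abs_nonneg y)

theorem excess_zero_left (y : ℝ) : excess 0 y = |y| := by simp [excess]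

theorem dist_excess_le (κ x y : ℝ) : dist (excess κ x) (excess κ y) ≤ dist x y := by
  rw [Real.dist_eq, Real.dist_eq, excess, excess]
  refine (abs_max_sub_max_le_abs _ _ _).trans ?_
  rw [sub_sub_sub_cancel_right]
  exact abs_abs_sub_abs_le_abs_sub x y

theorem continuous_excess (κ : ℝ) : Continuous (excess κ) := by
  unfold excess; fun_prop

/-- Truncated weighted sum of the excesses of the coordinates of `x` over `κ`. -/
def excessSum (w : ℕ → ℝ) (κ : ℝ) (x : ℕ → ℝ) (n : ℕ) : ℝ :=
  ∑ k ∈ Finset.range (n + 1), w k * excess κ (x k)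

theorem excessSum_mono {w : ℕ → ℝ} (hw : ∀ k, 0 ≤ w k) (κ : ℝ) (x : ℕ → ℝ) :
    Monotone (excessSum w κ x) := fun _ _ h =>
  Finset.sum_le_sum_of_subset_of_nonneg (Finset.range_mono (by omega))
    fun k _ _ => mul_nonneg (hw k) (excess_nonneg _ _)

theorem term_le_excessSum {w : ℕ → ℝ} (hw : ∀ k, 0 ≤ w k) (κ : ℝ) (x : ℕ → ℝ) {k n : ℕ}
    (h : k ≤ n) : w k * excess κ (x k) ≤ excessSum w κ x n :=
  Finset.single_le_sum (f := fun k => w k * excess κ (x k))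
    (fun i _ => mul_nonneg (hw i) (excess_nonneg _ _)) (Finset.mem_range.2 (by omega))

/-- The weighted sum of the right-hand sides of a cooperative birth and death system. -/
theorem sum_mul_le_of_cooperative {lam mu w v D : ℕ → ℝ} {A B β h : ℝ} {n : ℕ}
    (hw : ∀ k, 0 ≤ w k) (hv : ∀ k, 0 ≤ v k)
    (hD : ∀ k ≤ n, D k ≤ -(lam k * A + mu (k + 1) * B) * v k + lam k * A * pre h v k
      + mu (k + 1) * B * v (k + 1))
    (hβ : ∀ k ≤ n, β * w k ≤ w k * (lam k * A + mu (k + 1) * B) - w (k + 1) * (lam (k + 1) * A)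
      - prev w k * (mu k * B)) :
    ∑ k ∈ Finset.range (n + 1), w k * D k ≤
      -β * ∑ k ∈ Finset.range (n + 1), w k * v k + w 0 * lam 0 * A * h
        + w n * mu (n + 1) * B * v (n + 1) - w (n + 1) * (lam (n + 1) * A) * v n := by
  induction n with
  | zero =>
    have h1 := mul_le_mul_of_nonneg_left (hD 0 le_rfl) (hw 0)
    have h2 := mul_le_mul_of_nonneg_right (hβ 0 le_rfl) (hv 0)
    simp only [zero_add, Finset.range_one, Finset.sum_singleton, pre, prev] at *
    linarith
  | succ n ih =>
    -- The two boundary terms left at `n` cancel: the birth term of row `n + 1` compensates `w (n +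
    -- 1) * lam (n + 1) * A * v n`, and the `prev w` term of the column condition at `n + 1` absorbs
    -- the death inflow.
    have ih := ih (fun k hk => hD k (by omega)) (fun k hk => hβ k (by omega))
    have h1 := mul_le_mul_of_nonneg_left (hD (n + 1) le_rfl) (hw (n + 1))
    have h2 := mul_le_mul_of_nonneg_right (hβ (n + 1) le_rfl) (hv (n + 1))
    rw [Finset.sum_range_succ, Finset.sum_range_succ (fun k => w k * v k)]
    simp only [pre, prev] at h1 h2
    linarith

/-- Where |u_k| > κ, the modulus obeys the system as an inequality, and subtracting κ from every
coordinate changes nothing because the right-hand side involves differences only. At the lower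
boundary |η| ≤ |η| + κ suffices. -/
theorem deriv_excess_le {lam mu : ℕ → ℝ} {a b : ℝ → ℝ} {η κ r : ℝ} {u : ℝ → ℕ → ℝ} {k : ℕ}
    (hκ : 0 ≤ κ) (hl : 0 ≤ lam k * a r) (hm : 0 ≤ mu (k + 1) * b r)
    (hu : HasDerivAt (fun t => u t k) (tailGenerator lam mu a b η r (u r) k) r) :
    deriv (fun t => excess κ (u t k)) r ≤
      -(lam k * a r + mu (k + 1) * b r) * excess κ (u r k)
        + lam k * a r * pre |η| (fun j => excess κ (u r j)) k
        + mu (k + 1) * b r * excess κ (u r (k + 1)) := by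
  have hp : |pre η (u r) k| ≤ pre |η| (fun j => excess κ (u r j)) k + κ := by
    cases k with
    | zero => simpa [pre] using hκ
    | succ k => exact abs_le_excess_add κ _
  have hn := abs_le_excess_add κ (u r (k + 1))
  rcases (excess_nonneg κ (u r k)).eq_or_lt with h0 | h0
  -- An excess equal to zero is at its minimum, so `deriv` vanishes there, whether or not the
  -- function is differentiable, while the right-hand side is nonnegative.
  · have : IsLocalMin (fun t => excess κ (u t k)) r :=
      Eventually.of_forall fun t => h0.symm.le.trans (excess_nonneg κ _)
    rw [this.deriv_eq_zero, ← h0]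
    have h1 : 0 ≤ pre |η| (fun j => excess κ (u r j)) k := by
      cases k with
      | zero => exact abs_nonneg η
      | succ k => exact excess_nonneg κ _
    have := mul_nonneg hl h1
    have := mul_nonneg hm (excess_nonneg κ (u r (k + 1)))
    linarith
  · have h1 : 0 < |u r k| - κ := by
      by_contra h
      rw [excess, max_eq_right (not_lt.1 h)] at h0
      exact lt_irrefl _ h0
    have hev : (fun t => excess κ (u t k)) =ᶠ[𝓝 r] fun t => |u t k| - κ := by
      have hc : ContinuousAt (fun t => |u t k| - κ) r :=
        (hu.continuousAt.abs).sub continuousAt_const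
      filter_upwards [hc.eventually (lt_mem_nhds h1)] with t ht
      exact max_eq_left ht.le
    have hval : excess κ (u r k) = |u r k| - κ := max_eq_left h1.le
    rw [hev.deriv_eq, hval]
    have hne : u r k ≠ 0 := fun h => by rw [h, abs_zero] at h1; linarith
    have e1 : tailGenerator lam mu a b η r (u r) k =
      lam k * a r * (pre η (u r) k - u r k) - mu (k + 1) * b r * (u r k - u r (k + 1)) := rfl
    have hA := mul_le_mul_of_nonneg_left hp hl
    have hB := mul_le_mul_of_nonneg_left hn hm
    rcases lt_or_gt_of_ne hne with hneg | hpos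
    · have hd := ((hasDerivAt_abs_neg hneg).comp r hu).sub_const κ
      rw [show (fun t => |u t k| - κ) = fun t => ((fun x => |x|) ∘ fun t => u t k) t - κ from rfl,
        hd.deriv, e1, abs_of_neg hneg]
      have h3 := mul_le_mul_of_nonneg_left (neg_abs_le (pre η (u r) k)) hl
      have h4 := mul_le_mul_of_nonneg_left (neg_abs_le (u r (k + 1))) hm
      linarith
    · have hd := ((hasDerivAt_abs_pos hpos).comp r hu).sub_const κ
      rw [show (fun t => |u t k| - κ) = fun t => ((fun x => |x|) ∘ fun t => u t k) t - κ from rfl,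
        hd.deriv, e1, abs_of_pos hpos]
      have h3 := mul_le_mul_of_nonneg_left (le_abs_self (pre η (u r) k)) hl
      have h4 := mul_le_mul_of_nonneg_left (le_abs_self (u r (k + 1))) hm
      linarith

theorem IsTailSolution.intervalIntegrable_tailGenerator {N : ℕ∞} {lam mu : ℕ → ℝ} {a b : ℝ → ℝ}
    {η s t : ℝ} {u : ℝ → ℕ → ℝ} (hu : IsTailSolution N lam mu a b η s u) (hst : s ≤ t)
    (ha : IntervalIntegrable a volume s t) (hb : IntervalIntegrable b volume s t) (k : ℕ) :
    IntervalIntegrable (fun r => tailGenerator lam mu a b η r (u r) k) volume s t := by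
  have hc : ∀ j, ContinuousOn (fun r => u r j) (uIcc s t) := fun j =>
    (hu.cont j).mono (by rw [uIcc_of_le hst]; exact Icc_subset_Ici_self)
  have hp : ContinuousOn (fun r => pre η (u r) k) (uIcc s t) := by
    cases k with
    | zero => exact continuousOn_const
    | succ k => exact hc k
  exact ((ha.const_mul (lam k)).mul_continuousOn (hp.sub (hc k))).sub
    ((hb.const_mul (mu (k + 1))).mul_continuousOn ((hc k).sub (hc (k + 1))))

theorem IsTailSolution.absolutelyContinuousOnInterval {N : ℕ∞} {lam mu : ℕ → ℝ} {a b : ℝ → ℝ}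
    {η s t : ℝ} {u : ℝ → ℕ → ℝ} (hu : IsTailSolution N lam mu a b η s u) (hst : s ≤ t)
    (ha : IntervalIntegrable a volume s t) (hb : IntervalIntegrable b volume s t)
    {k : ℕ} (hk : (k : ℕ∞) < N) :
    AbsolutelyContinuousOnInterval (fun r => u r k) s t := by
  have h := (hu.intervalIntegrable_tailGenerator hst ha hb k
    ).absolutelyContinuousOnInterval_intervalIntegral (c := s) left_mem_uIcc
  refine absolutelyContinuousOnInterval_of_dist_le (C := 1) h fun x hx y hy => ?_
  rw [uIcc_of_le hst] at hx hy
  rw [hu.eq x hx.1 k hk, hu.eq y hy.1 k hk, dist_add_left, one_mul]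

theorem IsTailSolution.ae_hasDerivAt {N : ℕ∞} {lam mu : ℕ → ℝ} {a b : ℝ → ℝ}
    {η s t : ℝ} {u : ℝ → ℕ → ℝ} (hu : IsTailSolution N lam mu a b η s u) (hst : s ≤ t)
    (ha : IntervalIntegrable a volume s t) (hb : IntervalIntegrable b volume s t)
    {k : ℕ} (hk : (k : ℕ∞) < N) :
    ∀ᵐ r, r ∈ Ioo s t →
      HasDerivAt (fun r => u r k) (tailGenerator lam mu a b η r (u r) k) r := by
  filter_upwards [(hu.intervalIntegrable_tailGenerator hst ha hb k).ae_hasDerivAt_integral]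
    with r hr hI
  have h := hr (by rw [uIcc_of_le hst]; exact Ioo_subset_Icc_self hI) s left_mem_uIcc
  refine (h.const_add (u s k)).congr_of_eventuallyEq ?_
  filter_upwards [Ioo_mem_nhds hI.1 hI.2] with q hq
  exact hu.eq q hq.1.le k hk

/-- The basic weighted estimate, for finitely many coordinates. -/
theorem IsTailSolution.excessSum_mul_exp_le {N : ℕ∞} {lam mu : ℕ → ℝ} {a b : ℝ → ℝ}
    {η s t κ : ℝ} {u : ℝ → ℕ → ℝ} (hu : IsTailSolution N lam mu a b η s u) (hst : s ≤ t)
    (ha : IntervalIntegrable a volume s t) (hb : IntervalIntegrable b volume s t)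
    (ha0 : ∀ r, s ≤ r → 0 ≤ a r) (hb0 : ∀ r, s ≤ r → 0 ≤ b r) (hκ : 0 ≤ κ)
    (hlam : ∀ k : ℕ, (k : ℕ∞) ≤ N → 0 ≤ lam k)
    (hmu : ∀ k : ℕ, (k : ℕ∞) < N → 0 ≤ mu (k + 1))
    {w : ℕ → ℝ} (hw : ∀ k, 0 ≤ w k) {n : ℕ} (hn : (n : ℕ∞) < N)
    {β : ℝ → ℝ} (hβi : IntervalIntegrable β volume s t)
    (hβ : ∀ r, s ≤ r → ∀ k ≤ n, β r * w k ≤ w k * (lam k * a r + mu (k + 1) * b r)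
      - w (k + 1) * (lam (k + 1) * a r) - prev w k * (mu k * b r)) :
    excessSum w κ (u t) n * Real.exp (∫ r in s..t, β r) ≤
      excessSum w κ (u s) n + ∫ r in s..t, Real.exp (∫ q in s..r, β q) *
        (w 0 * lam 0 * a r * |η| + w n * mu (n + 1) * b r * excess κ (u r (n + 1))) := by
  have hlt : ∀ {k : ℕ}, k ≤ n → (k : ℕ∞) < N := fun hk =>
    lt_of_le_of_lt (by exact_mod_cast hk) hn
  have hAC : ∀ k ∈ Finset.range (n + 1), AbsolutelyContinuousOnInterval
      (fun r => w k * excess κ (u r k)) s t := fun k hk => by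
    have h := hu.absolutelyContinuousOnInterval hst ha hb
      (hlt (Nat.lt_succ_iff.1 (Finset.mem_range.1 hk)))
    exact (absolutelyContinuousOnInterval_of_dist_le (C := 1) h fun x _ y _ => by
      rw [one_mul]; exact dist_excess_le _ _ _).const_mul (w k)
  have hcn : ContinuousOn (fun r => excess κ (u r (n + 1))) (uIcc s t) :=
    (continuous_excess κ).comp_continuousOn
      ((hu.cont _).mono (by rw [uIcc_of_le hst]; exact Icc_subset_Ici_self))
  have hh : IntervalIntegrable (fun r => w 0 * lam 0 * a r * |η|
      + w n * mu (n + 1) * b r * excess κ (u r (n + 1))) volume s t :=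
    ((ha.const_mul _).mul_const _).add ((hb.const_mul _).mul_continuousOn hcn)
  refine AbsolutelyContinuousOnInterval.mul_exp_integral_le
    (S := fun r => excessSum w κ (u r) n) hst
    (AbsolutelyContinuousOnInterval.fun_sum hAC) hβi hh ?_
  have h1 : ∀ᵐ r, ∀ k : ℕ, k ≤ n → r ∈ Ioo s t →
      HasDerivAt (fun r => u r k) (tailGenerator lam mu a b η r (u r) k) r := by
    refine ae_all_iff.2 fun k => ?_
    by_cases hk : k ≤ n
    · filter_upwards [hu.ae_hasDerivAt hst ha hb (hlt hk)] with r hr _ using hr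
    · exact Eventually.of_forall fun r h => absurd h hk
  have h2 : ∀ᵐ r, ∀ k : ℕ, k ≤ n → r ∈ Ioo s t →
      DifferentiableAt ℝ (fun r => excess κ (u r k)) r := by
    refine ae_all_iff.2 fun k => ?_
    by_cases hk : k ≤ n
    · have h := hu.absolutelyContinuousOnInterval hst ha hb (hlt hk)
      have h' : AbsolutelyContinuousOnInterval (fun r => excess κ (u r k)) s t :=
        absolutelyContinuousOnInterval_of_dist_le (C := 1) h fun x _ y _ => by
          rw [one_mul]; exact dist_excess_le _ _ _
      filter_upwards [h'.ae_differentiableAt] with r hr _ hI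
      exact hr (by rw [uIcc_of_le hst]; exact Ioo_subset_Icc_self hI)
    · exact Eventually.of_forall fun r h => absurd h hk
  filter_upwards [h1, h2] with r hr1 hr2 hI
  have hsr := hI.1.le
  have hd : HasDerivAt (fun r => excessSum w κ (u r) n)
      (∑ k ∈ Finset.range (n + 1), w k * deriv (fun r => excess κ (u r k)) r) r :=
    HasDerivAt.fun_sum fun k hk =>
      ((hr2 k (Nat.lt_succ_iff.1 (Finset.mem_range.1 hk)) hI).hasDerivAt).const_mul (w k)
  rw [hd.deriv]
  have := sum_mul_le_of_cooperative (lam := lam) (mu := mu) (w := w)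
    (v := fun j => excess κ (u r j)) (D := fun k => deriv (fun r => excess κ (u r k)) r)
    (A := a r) (B := b r) (β := β r) (h := |η|) (n := n) hw (fun k => excess_nonneg _ _)
    (fun k hk => deriv_excess_le hκ (mul_nonneg (hlam k (hlt hk).le) (ha0 r hsr))
      (mul_nonneg (hmu k (hlt hk)) (hb0 r hsr)) (hr1 k hk hI)) (hβ r hsr)
  -- This boundary term has a favourable sign and is dropped; only the inflow from coordinate `n +
  -- 1` survives in the estimate.
  have h3 : 0 ≤ w (n + 1) * (lam (n + 1) * a r) * excess κ (u r n) :=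
    mul_nonneg (mul_nonneg (hw _) (mul_nonneg (hlam (n + 1)
      (by exact_mod_cast Order.add_one_le_of_lt hn)) (ha0 r hsr))) (excess_nonneg _ _)
  unfold excessSum
  linarith

theorem excess_le_one_of_abs_le {κ y : ℝ} (hκ : 0 ≤ κ) (hy : |y| ≤ 1) : excess κ y ≤ 1 :=
  (excess_le_abs hκ y).trans hy

theorem exp_integral_le_one {β : ℝ → ℝ} {s t : ℝ} (hst : s ≤ t) (hβ : ∀ r, s ≤ r → β r ≤ 0) :
    Real.exp (∫ r in s..t, β r) ≤ 1 := by
  rw [Real.exp_le_one_iff]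
  have := intervalIntegral.integral_nonneg (μ := volume) (f := fun r => -β r) hst
    fun r hr => neg_nonneg.2 (hβ r hr.1)
  rw [intervalIntegral.integral_neg] at this
  linarith

/-- Weights of bounded growth can be replaced by summable ones on any initial segment. -/
theorem exists_weight_tendsto_zero {w : ℕ → ℝ} {R : ℝ} (hw : ∀ k, 0 < w k) (hR : 2 ≤ R)
    (hR1 : ∀ k, w (k + 1) ≤ R * w k) (hR2 : ∀ k, w k ≤ R * w (k + 1)) (m : ℕ) :
    ∃ w' : ℕ → ℝ, (∀ k, 0 ≤ w' k) ∧ (∀ k, w' k ≤ w k) ∧ (∀ k ≤ m, w' k = w k) ∧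
      (∀ k, w' (k + 1) ≤ R * w' k) ∧ (∀ k, w' k ≤ R * w' (k + 1)) ∧
      Tendsto w' atTop (𝓝 0) := by
  -- With this `A` the geometric sequence A / 2^k dominates `w k` for k ≤ m, so the minimum of the
  -- two keeps the first weights. Its step ratios stay within R because R ≥ 2.
  set A : ℝ := ∑ k ∈ Finset.range (m + 1), w k * 2 ^ k with hA
  have hA0 : 0 ≤ A := Finset.sum_nonneg fun k _ => mul_nonneg (hw k).le (by positivity)
  have hq : ∀ k : ℕ, 0 ≤ A / 2 ^ k := fun k => by positivity
  have hq' : ∀ k : ℕ, A / 2 ^ (k + 1) = A / 2 ^ k / 2 := fun k => by rw [pow_succ]; field_simp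
  have hR0 : (0 : ℝ) ≤ R := by linarith
  have hmul : ∀ k, R * min (w k) (A / 2 ^ k) = min (R * w k) (R * (A / 2 ^ k)) := fun k =>
    (mul_min_of_nonneg _ _ hR0)
  refine ⟨fun k => min (w k) (A / 2 ^ k), fun k => le_min (hw k).le (hq k),
    fun k => min_le_left _ _, fun k hk => min_eq_left ?_, fun k => ?_, fun k => ?_, ?_⟩
  · rw [le_div_iff₀ (by positivity)]
    exact Finset.single_le_sum (f := fun k => w k * 2 ^ k)
      (fun i _ => mul_nonneg (hw i).le (by positivity)) (Finset.mem_range.2 (by omega))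
  · simp only [hmul]
    refine min_le_min (hR1 k) ?_
    rw [hq']
    nlinarith [hq k]
  · simp only [hmul]
    refine min_le_min (hR2 k) ?_
    rw [hq']
    nlinarith [hq k]
  · refine squeeze_zero (fun k => le_min (hw k).le (hq k)) (fun k => min_le_right _ _) ?_
    have := (tendsto_pow_atTop_nhds_zero_of_lt_one (r := (1 / 2 : ℝ)) (by norm_num)
      (by norm_num)).const_mul A
    simpa [div_eq_mul_inv] using this

/-! ### Removing the truncation on an infinite state space -/

section Infinite

variable {lam mu : ℕ → ℝ} {a b : ℝ → ℝ} {η s t κ Λ R S₀ : ℝ} {u : ℝ → ℕ → ℝ} {w : ℕ → ℝ}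

/-- Finiteness of the weighted norm is preserved by the tail system on an infinite state space. -/
theorem IsTailSolution.exists_excessSum_le (hu : IsTailSolution ⊤ lam mu a b η s u) (hst : s ≤ t)
    (ha : IntervalIntegrable a volume s t) (hb : IntervalIntegrable b volume s t)
    (ha0 : ∀ r, s ≤ r → 0 ≤ a r) (hb0 : ∀ r, s ≤ r → 0 ≤ b r) (hκ : 0 ≤ κ)
    (hlam : ∀ k, 0 ≤ lam k) (hmu : ∀ k, 0 ≤ mu k)
    (hlam' : ∀ k, lam k ≤ Λ) (hmu' : ∀ k, mu k ≤ Λ)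
    (hw : ∀ k, 0 < w k) (hR : 2 ≤ R)
    (hR1 : ∀ k, w (k + 1) ≤ R * w k) (hR2 : ∀ k, w k ≤ R * w (k + 1))
    (hS : ∀ m, excessSum w κ (u s) m ≤ S₀) :
    ∃ B, ∀ r ∈ Icc s t, ∀ m, excessSum w κ (u r) m ≤ B := by
  -- Rates bounded by Λ and weight ratios bounded by R make -C (a + b) a crude admissible rate, also
  -- for the modified weights.
  set C := R * Λ with hC
  have hΛ : 0 ≤ Λ := (hlam 0).trans (hlam' 0)
  have hR0 : (0 : ℝ) ≤ R := by linarith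
  have hC0 : 0 ≤ C := mul_nonneg hR0 hΛ
  refine ⟨Real.exp (∫ q in s..t, C * (a q + b q)) *
    (S₀ + w 0 * lam 0 * |η| * ∫ q in s..t, a q), fun r hr m => ?_⟩
  have hsub : uIcc s r ⊆ uIcc s t := by
    rw [uIcc_of_le hst, uIcc_of_le hr.1]; exact Icc_subset_Icc_right hr.2
  have ha' := ha.mono_set hsub
  have hb' := hb.mono_set hsub
  obtain ⟨w', hw0, hww, hwm, hw1, hw2, hwt⟩ := exists_weight_tendsto_zero hw hR hR1 hR2 m
  have hβi : IntervalIntegrable (fun q => -(C * (a q + b q))) volume s r :=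
    ((ha'.add hb').const_mul C).neg
  have hβ : ∀ q, s ≤ q → ∀ k : ℕ, -(C * (a q + b q)) * w' k ≤
      w' k * (lam k * a q + mu (k + 1) * b q) - w' (k + 1) * (lam (k + 1) * a q)
        - prev w' k * (mu k * b q) := fun q hq k => by
    have h1 : w' (k + 1) * (lam (k + 1) * a q) ≤ (R * w' k) * (Λ * a q) :=
      mul_le_mul (hw1 k) (mul_le_mul_of_nonneg_right (hlam' _) (ha0 q hq))
        (mul_nonneg (hlam _) (ha0 q hq)) (mul_nonneg hR0 (hw0 k))
    have hp : prev w' k ≤ R * w' k := by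
      cases k with
      | zero => exact mul_nonneg hR0 (hw0 0)
      | succ k => exact hw2 k
    have h2 : prev w' k * (mu k * b q) ≤ (R * w' k) * (Λ * b q) :=
      mul_le_mul hp (mul_le_mul_of_nonneg_right (hmu' _) (hb0 q hq))
        (mul_nonneg (hmu _) (hb0 q hq)) (mul_nonneg hR0 (hw0 k))
    have h3 : 0 ≤ w' k * (lam k * a q + mu (k + 1) * b q) :=
      mul_nonneg (hw0 k) (add_nonneg (mul_nonneg (hlam k) (ha0 q hq))
        (mul_nonneg (hmu _) (hb0 q hq)))
    rw [hC]
    linarith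
  have hneg : ∀ q, s ≤ q → -(C * (a q + b q)) ≤ 0 := fun q hq =>
    neg_nonpos.2 (mul_nonneg hC0 (add_nonneg (ha0 q hq) (hb0 q hq)))
  -- Since |u| ≤ 1, the boundary flux is at most w'_n Λ ∫ b, which disappears as n → ∞ with m fixed.
  have key : ∀ n, m ≤ n → excessSum w κ (u r) m * Real.exp (∫ q in s..r, -(C * (a q + b q))) ≤
      (S₀ + w 0 * lam 0 * |η| * ∫ q in s..r, a q) + w' n * (Λ * ∫ q in s..r, b q) := by
    intro n hn
    have h := hu.excessSum_mul_exp_le hr.1 ha' hb' ha0 hb0 hκ (fun k _ => hlam k)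
      (fun k _ => hmu _) hw0 (ENat.natCast_lt_top n) hβi (fun q hq k _ => hβ q hq k)
    have hm : excessSum w κ (u r) m ≤ excessSum w' κ (u r) n := by
      refine le_trans (le_of_eq ?_) (excessSum_mono hw0 κ (u r) hn)
      exact Finset.sum_congr rfl fun k hk => by
        rw [hwm k (Nat.lt_succ_iff.1 (Finset.mem_range.1 hk))]
    have hs0 : excessSum w' κ (u s) n ≤ S₀ :=
      le_trans (Finset.sum_le_sum fun k _ =>
        mul_le_mul_of_nonneg_right (hww k) (excess_nonneg _ _)) (hS n)
    have hint : ∫ q in s..r, Real.exp (∫ p in s..q, -(C * (a p + b p))) *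
        (w' 0 * lam 0 * a q * |η| + w' n * mu (n + 1) * b q * excess κ (u q (n + 1))) ≤
        ∫ q in s..r, ((w 0 * lam 0 * |η|) * a q + (w' n * Λ) * b q) := by
      have hcE : ContinuousOn (fun q => Real.exp (∫ p in s..q, -(C * (a p + b p)))) (uIcc s r) :=
        (AbsolutelyContinuousOnInterval.exp
          (hβi.absolutelyContinuousOnInterval_intervalIntegral left_mem_uIcc)).continuousOn
      have hcn : ContinuousOn (fun q => excess κ (u q (n + 1))) (uIcc s r) :=
        (continuous_excess κ).comp_continuousOn
          ((hu.cont _).mono (by rw [uIcc_of_le hr.1]; exact Icc_subset_Ici_self))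
      refine intervalIntegral.integral_mono_on hr.1
        ((((ha'.const_mul _).mul_const _).add
          ((hb'.const_mul _).mul_continuousOn hcn)).continuousOn_mul hcE)
        ((ha'.const_mul _).add (hb'.const_mul _)) fun q hq => ?_
      have e1 := exp_integral_le_one hq.1 hneg
      have i1 : w' 0 * lam 0 * a q * |η| ≤ (w 0 * lam 0 * |η|) * a q := by
        have := mul_le_mul_of_nonneg_right (hww 0)
          (mul_nonneg (mul_nonneg (hlam 0) (ha0 q hq.1)) (abs_nonneg η))
        linarith
      have i0 : 0 ≤ w' 0 * lam 0 * a q * |η| := mul_nonneg (mul_nonneg (mul_nonneg (hw0 0)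
        (hlam 0)) (ha0 q hq.1)) (abs_nonneg η)
      have j0 : 0 ≤ w' n * mu (n + 1) * b q := mul_nonneg (mul_nonneg (hw0 n)
        (hmu _)) (hb0 q hq.1)
      have j1 : w' n * mu (n + 1) * b q * excess κ (u q (n + 1)) ≤ (w' n * Λ) * b q := by
        refine (mul_le_of_le_one_right j0
          (excess_le_one_of_abs_le hκ (hu.abs_le q hq.1 _))).trans ?_
        exact mul_le_mul_of_nonneg_right (mul_le_mul_of_nonneg_left (hmu' _) (hw0 n))
          (hb0 q hq.1)
      refine (mul_le_of_le_one_left (add_nonneg i0 (mul_nonneg j0 (excess_nonneg _ _))) e1).trans ?_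
      linarith
    rw [intervalIntegral.integral_add (ha'.const_mul _) (hb'.const_mul _),
      intervalIntegral.integral_const_mul, intervalIntegral.integral_const_mul] at hint
    have h5 := mul_le_mul_of_nonneg_right hm
      (Real.exp_pos (∫ q in s..r, -(C * (a q + b q)))).le
    linarith
  have hlim : Tendsto (fun n => (S₀ + w 0 * lam 0 * |η| * ∫ q in s..r, a q)
      + w' n * (Λ * ∫ q in s..r, b q)) atTop
      (𝓝 (S₀ + w 0 * lam 0 * |η| * ∫ q in s..r, a q)) := by
    simpa using (hwt.mul_const (Λ * ∫ q in s..r, b q)).const_add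
      (S₀ + w 0 * lam 0 * |η| * ∫ q in s..r, a q)
  have h6 := ge_of_tendsto hlim ((eventually_ge_atTop m).mono key)
  have hmono : ∀ g : ℝ → ℝ, IntervalIntegrable g volume s t → (∀ q, s ≤ q → 0 ≤ g q) →
      ∫ q in s..r, g q ≤ ∫ q in s..t, g q := fun g hg hg0 =>
    intervalIntegral.integral_mono_interval le_rfl hr.1 hr.2
      ((ae_restrict_iff' measurableSet_Ioc).2 (Eventually.of_forall fun q hq => hg0 q hq.1.le)) hg
  have hab := hmono _ ((ha.add hb).const_mul C) fun q hq =>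
    mul_nonneg hC0 (add_nonneg (ha0 q hq) (hb0 q hq))
  have haa := hmono a ha ha0
  rw [intervalIntegral.integral_neg, Real.exp_neg, ← div_eq_mul_inv,
    div_le_iff₀ (Real.exp_pos _), mul_comm] at h6
  have hS0 : 0 ≤ S₀ := le_trans (Finset.sum_nonneg fun k _ =>
    mul_nonneg (hw k).le (excess_nonneg _ _)) (hS 0)
  have hw0l : 0 ≤ w 0 * lam 0 * |η| :=
    mul_nonneg (mul_nonneg (hw 0).le (hlam 0)) (abs_nonneg η)
  have h0 : 0 ≤ ∫ q in s..t, a q :=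
    intervalIntegral.integral_nonneg hst fun q hq => ha0 q hq.1
  refine h6.trans (mul_le_mul (Real.exp_le_exp.2 hab)
    (add_le_add le_rfl (mul_le_mul_of_nonneg_left haa hw0l)) ?_ (Real.exp_pos _).le)
  exact add_nonneg hS0 (mul_nonneg hw0l
    (intervalIntegral.integral_nonneg hr.1 fun q hq => ha0 q hq.1))

/-- The weighted estimate on an infinite state space. -/
theorem IsTailSolution.excessSum_mul_exp_le_of_top (hu : IsTailSolution ⊤ lam mu a b η s u)
    (hst : s ≤ t)
    (ha : IntervalIntegrable a volume s t) (hb : IntervalIntegrable b volume s t)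
    (ha0 : ∀ r, s ≤ r → 0 ≤ a r) (hb0 : ∀ r, s ≤ r → 0 ≤ b r) (hκ : 0 ≤ κ)
    (hlam : ∀ k, 0 ≤ lam k) (hmu : ∀ k, 0 ≤ mu k)
    (hlam' : ∀ k, lam k ≤ Λ) (hmu' : ∀ k, mu k ≤ Λ)
    (hw : ∀ k, 0 < w k) (hR : 2 ≤ R)
    (hR1 : ∀ k, w (k + 1) ≤ R * w k) (hR2 : ∀ k, w k ≤ R * w (k + 1))
    (hS : ∀ m, excessSum w κ (u s) m ≤ S₀)
    {β : ℝ → ℝ} (hβi : IntervalIntegrable β volume s t)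
    (hβ : ∀ r, s ≤ r → ∀ k, β r * w k ≤ w k * (lam k * a r + mu (k + 1) * b r)
      - w (k + 1) * (lam (k + 1) * a r) - prev w k * (mu k * b r)) (m : ℕ) :
    excessSum w κ (u t) m * Real.exp (∫ r in s..t, β r) ≤
      S₀ + w 0 * lam 0 * |η| * ∫ r in s..t, Real.exp (∫ q in s..r, β q) * a r := by
  obtain ⟨B, hB⟩ := hu.exists_excessSum_le hst ha hb ha0 hb0 hκ hlam hmu hlam' hmu' hw hR hR1
    hR2 hS
  have hw' : ∀ k, 0 ≤ w k := fun k => (hw k).le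
  have hR0 : (0 : ℝ) ≤ R := by linarith
  have hΛ : 0 ≤ Λ := (hlam 0).trans (hlam' 0)
  have hcE : ContinuousOn (fun q => Real.exp (∫ p in s..q, β p)) (uIcc s t) :=
    (AbsolutelyContinuousOnInterval.exp
      (hβi.absolutelyContinuousOnInterval_intervalIntegral left_mem_uIcc)).continuousOn
  obtain ⟨E, hE⟩ := (isCompact_uIcc (a := s) (b := t)).exists_bound_of_continuousOn hcE
  have hE' : ∀ q ∈ Icc s t, Real.exp (∫ p in s..q, β p) ≤ E := fun q hq =>
    (Real.le_norm_self _).trans (hE q (by rwa [uIcc_of_le hst]))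
  have hE0 : 0 ≤ E := (Real.exp_pos _).le.trans (hE' s (left_mem_Icc.2 hst))
  have hcn : ∀ n, ContinuousOn (fun q => excess κ (u q n)) (uIcc s t) := fun n =>
    (continuous_excess κ).comp_continuousOn
      ((hu.cont _).mono (by rw [uIcc_of_le hst]; exact Icc_subset_Ici_self))
  have hiv : ∀ n, IntervalIntegrable (fun q => b q * (w n * excess κ (u q n))) volume s t :=
    fun n => hb.mul_continuousOn (continuousOn_const.mul (hcn n))
  -- Up to constants, c (n + 1) bounds the time-integrated boundary flux at n. The uniform bound B
  -- on the partial sums makes ∑ c n converge, hence c n → 0, now for the original weights and the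
  -- sharp rate β.
  set c : ℕ → ℝ := fun n => ∫ q in s..t, b q * (w n * excess κ (u q n)) with hc
  have hc0 : ∀ n, 0 ≤ c n := fun n => intervalIntegral.integral_nonneg hst fun q hq =>
    mul_nonneg (hb0 q hq.1) (mul_nonneg (hw' n) (excess_nonneg _ _))
  have hsum : Summable c := by
    refine summable_of_sum_range_le (c := B * ∫ q in s..t, b q) hc0 fun n => ?_
    refine le_trans (Finset.sum_le_sum_of_subset_of_nonneg (t := Finset.range (n + 1))
      (Finset.range_mono (Nat.le_succ n)) fun i _ _ => hc0 i) ?_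
    rw [hc, ← intervalIntegral.integral_finsetSum fun i _ => hiv i,
      ← intervalIntegral.integral_const_mul]
    refine intervalIntegral.integral_mono_on hst ?_ (hb.const_mul B) fun q hq => ?_
    · have := IntervalIntegrable.sum (Finset.range (n + 1)) fun i _ => hiv i
      simpa only [Finset.sum_fn] using this
    · rw [← Finset.mul_sum, mul_comm B]
      exact mul_le_mul_of_nonneg_left (hB q hq n) (hb0 q hq.1)
  have hlim : Tendsto (fun n => (S₀ + w 0 * lam 0 * |η| *
      ∫ r in s..t, Real.exp (∫ q in s..r, β q) * a r) + E * (R * Λ) * c (n + 1)) atTop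
      (𝓝 (S₀ + w 0 * lam 0 * |η| * ∫ r in s..t, Real.exp (∫ q in s..r, β q) * a r)) := by
    simpa using ((hsum.tendsto_atTop_zero.comp (tendsto_add_atTop_nat 1)).const_mul
      (E * (R * Λ))).const_add
        (S₀ + w 0 * lam 0 * |η| * ∫ r in s..t, Real.exp (∫ q in s..r, β q) * a r)
  refine ge_of_tendsto hlim ((eventually_ge_atTop m).mono fun n hn => ?_)
  have h := hu.excessSum_mul_exp_le hst ha hb ha0 hb0 hκ (fun k _ => hlam k)
    (fun k _ => hmu _) hw' (ENat.natCast_lt_top n) hβi (fun q hq k _ => hβ q hq k)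
  have h5 := mul_le_mul_of_nonneg_right (excessSum_mono hw' κ (u t) hn)
    (Real.exp_pos (∫ q in s..t, β q)).le
  have hint : ∫ q in s..t, Real.exp (∫ p in s..q, β p) *
      (w 0 * lam 0 * a q * |η| + w n * mu (n + 1) * b q * excess κ (u q (n + 1))) ≤
      ∫ q in s..t, ((w 0 * lam 0 * |η|) * (Real.exp (∫ p in s..q, β p) * a q)
        + (E * (R * Λ)) * (b q * (w (n + 1) * excess κ (u q (n + 1))))) := by
    refine intervalIntegral.integral_mono_on hst
      ((((ha.const_mul _).mul_const _).add
        ((hb.const_mul _).mul_continuousOn (hcn _))).continuousOn_mul hcE)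
      (((ha.continuousOn_mul hcE).const_mul _).add ((hiv _).const_mul _)) fun q hq => ?_
    have hv := excess_nonneg κ (u q (n + 1))
    have i1 : w n * mu (n + 1) ≤ (R * w (n + 1)) * Λ :=
      mul_le_mul (hR2 n) (hmu' _) (hmu _) (mul_nonneg hR0 (hw' _))
    have i2 := mul_le_mul_of_nonneg_right i1 (mul_nonneg (hb0 q hq.1) hv)
    have i3 : Real.exp (∫ p in s..q, β p) * (w n * mu (n + 1) * (b q * excess κ (u q (n + 1)))) ≤
        E * (R * w (n + 1) * Λ * (b q * excess κ (u q (n + 1)))) :=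
      mul_le_mul (hE' q hq) i2 (mul_nonneg (mul_nonneg (hw' _) (hmu _))
        (mul_nonneg (hb0 q hq.1) hv)) hE0
    linarith
  rw [intervalIntegral.integral_add ((ha.continuousOn_mul hcE).const_mul _)
    ((hiv _).const_mul _), intervalIntegral.integral_const_mul,
    intervalIntegral.integral_const_mul] at hint
  have := hS n
  simp only [hc]
  linarith

end Infinite

/-- The weighted estimate on a finite state space. -/
theorem IsTailSolution.excessSum_mul_exp_le_of_finite {lam mu : ℕ → ℝ} {a b : ℝ → ℝ}
    {s t : ℝ} {u : ℝ → ℕ → ℝ} {w : ℕ → ℝ} {n : ℕ}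
    (hu : IsTailSolution ((n + 1 : ℕ) : ℕ∞) lam mu a b 0 s u)
    (hst : s ≤ t)
    (ha : IntervalIntegrable a volume s t) (hb : IntervalIntegrable b volume s t)
    (ha0 : ∀ r, s ≤ r → 0 ≤ a r) (hb0 : ∀ r, s ≤ r → 0 ≤ b r)
    (hlam : ∀ k ≤ n + 1, 0 ≤ lam k) (hmu : ∀ k ≤ n, 0 ≤ mu (k + 1)) (hw : ∀ k, 0 ≤ w k)
    {β : ℝ → ℝ} (hβi : IntervalIntegrable β volume s t)
    (hβ : ∀ r, s ≤ r → ∀ k ≤ n, β r * w k ≤ w k * (lam k * a r + mu (k + 1) * b r)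
      - w (k + 1) * (lam (k + 1) * a r) - prev w k * (mu k * b r)) :
    excessSum w 0 (u t) n * Real.exp (∫ r in s..t, β r) ≤ excessSum w 0 (u s) n := by
  have h := hu.excessSum_mul_exp_le hst ha hb ha0 hb0 le_rfl (fun k hk => hlam k (by
    exact_mod_cast hk)) (fun k hk => hmu k (Nat.lt_succ_iff.1 (by exact_mod_cast hk))) hw
    (n := n) (by exact_mod_cast Nat.lt_succ_self n) hβi hβ
  -- No source because η = 0, and no boundary flux because the tail beyond the last state is zero.
  have h0 : ∫ r in s..t, Real.exp (∫ q in s..r, β q) * (w 0 * lam 0 * a r * |(0 : ℝ)|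
      + w n * mu (n + 1) * b r * excess 0 (u r (n + 1))) = 0 := by
    rw [intervalIntegral.integral_congr (g := fun _ => (0 : ℝ)), intervalIntegral.integral_zero]
    intro r hr
    rw [uIcc_of_le hst] at hr
    simp [hu.eq_zero r hr.1 (n + 1) le_rfl, excess]
  rw [h0, add_zero] at h
  exact h

/-! ### Asymptotically periodic functions -/

theorem AsymptoticallyPeriodic.intervalIntegrable {g g₁ g₂ : ℝ → ℝ} {T s t : ℝ}
    (h : AsymptoticallyPeriodic g g₁ g₂ T) (hs : 0 ≤ s) (ht : 0 ≤ t) :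
    IntervalIntegrable g volume s t := by
  rw [intervalIntegrable_iff']
  refine h.locallyIntegrable.integrableOn_compact_subset (fun x hx => ?_) isCompact_uIcc
  exact (le_min hs ht).trans hx.1

theorem AsymptoticallyPeriodic.periodic_nat {g g₁ g₂ : ℝ → ℝ} {T t : ℝ}
    (h : AsymptoticallyPeriodic g g₁ g₂ T) (ht : 0 ≤ t) (n : ℕ) : g₁ (t + n * T) = g₁ t := by
  induction n with
  | zero => simp
  | succ n ih =>
    rw [← ih, ← h.periodic (t + n * T) (by have := h.period_pos; positivity)]
    congr 1; push_cast; ring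

/-- Regularity is assumed of g only. On one period g₁ is the pointwise limit of the translates g(· +
nT), hence measurable, and a late translate dominates it up to the constant 1. -/
theorem AsymptoticallyPeriodic.intervalIntegrable_period {g g₁ g₂ : ℝ → ℝ} {T : ℝ}
    (h : AsymptoticallyPeriodic g g₁ g₂ T) : IntervalIntegrable g₁ volume 0 T := by
  have hT := h.period_pos
  have hshift : ∀ n : ℕ, IntervalIntegrable (fun t => g (t + n * T)) volume 0 T := fun n => by
    have := (h.intervalIntegrable (s := n * T) (t := T + n * T) (by positivity)
      (by positivity)).comp_add_right (n * T)
    simpa using this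
  have hsh : Tendsto (fun n : ℕ => (n : ℝ) * T) atTop atTop :=
    tendsto_natCast_atTop_atTop.atTop_mul_const hT
  have hval : ∀ t, 0 ≤ t → ∀ n : ℕ, g (t + n * T) = g₁ t + g₂ (t + n * T) := fun t ht n => by
    rw [h.decomp _ (by positivity), h.periodic_nat ht]
  obtain ⟨r, hr⟩ := (h.vanish.eventually (Metric.closedBall_mem_nhds 0 one_pos)).exists_forall_of_atTop
  obtain ⟨n, hn⟩ := (hsh.eventually_ge_atTop r).exists
  rw [intervalIntegrable_iff_integrableOn_Ioc_of_le hT.le]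
  have hsn := fun n => (intervalIntegrable_iff_integrableOn_Ioc_of_le hT.le).1 (hshift n)
  refine Integrable.mono' ((hsn n).norm.add (integrable_const (1 : ℝ))) ?_ ?_
  · refine aestronglyMeasurable_of_tendsto_ae atTop (fun n => (hsn n).aestronglyMeasurable) ?_
    refine (ae_restrict_iff' measurableSet_Ioc).2 (Eventually.of_forall fun t ht => ?_)
    have : Tendsto (fun n : ℕ => g₁ t + g₂ (t + n * T)) atTop (𝓝 (g₁ t + 0)) :=
      (h.vanish.comp (tendsto_atTop_add_const_left _ t hsh)).const_add _
    rw [add_zero] at this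
    exact this.congr fun n => (hval t ht.1.le n).symm
  · refine (ae_restrict_iff' measurableSet_Ioc).2 (Eventually.of_forall fun t ht => ?_)
    have h1 := hr (t + n * T) (by linarith [ht.1])
    rw [dist_zero_right, Real.norm_eq_abs] at h1
    have h2 := hval t ht.1.le n
    simp only [Pi.add_apply, Real.norm_eq_abs]
    rw [show g₁ t = g (t + n * T) - g₂ (t + n * T) by linarith]
    exact (abs_sub _ _).trans (by linarith)

/-- The integrals of an asymptotically periodic function over long intervals. -/
theorem AsymptoticallyPeriodic.abs_integral_sub_le {g g₁ g₂ : ℝ → ℝ} {T : ℝ}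
    (h : AsymptoticallyPeriodic g g₁ g₂ T) {ε : ℝ} (hε : 0 < ε) :
    ∃ C, ∀ s t, 0 ≤ s → s ≤ t →
      |(∫ r in s..t, g r) - periodMean g₁ T * (t - s)| ≤ ε * (t - s) + C := by
  have hT := h.period_pos
  set m := periodMean g₁ T with hm
  -- The periodicity of `g₁` is assumed on [0, ∞) only; `p` extends it to a function periodic on the
  -- whole line.
  set p : ℝ → ℝ := fun t => g₁ (T * Int.fract (t / T)) with hp
  have hpp : Function.Periodic p T := fun t => by
    simp only [hp]
    rw [add_div, div_self hT.ne', Int.fract_add_one]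
  have hpg : ∀ t, 0 ≤ t → p t = g₁ t := fun t ht => by
    have h1 : (0 : ℤ) ≤ ⌊t / T⌋ := Int.floor_nonneg.2 (by positivity)
    obtain ⟨n, hn⟩ := Int.eq_ofNat_of_zero_le h1
    have h2 := Int.fract_add_floor (t / T)
    rw [hn] at h2
    have h3 : t = T * Int.fract (t / T) + n * T := by
      push_cast at h2
      field_simp at h2
      linarith
    have h4 := h.periodic_nat (t := T * Int.fract (t / T))
      (mul_nonneg hT.le (Int.fract_nonneg _)) n
    rw [← h3] at h4
    exact h4.symm
  have hpi : IntervalIntegrable p volume 0 T :=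
    h.intervalIntegrable_period.congr fun t ht => by
      rw [uIoc_of_le hT.le] at ht
      exact (hpg t ht.1.le).symm
  have hpI : ∀ s t, IntervalIntegrable p volume s t := fun s t =>
    hpp.intervalIntegrable₀ hT.ne' hpi s t
  have hq : Function.Periodic (fun t => p t - m) T := fun t => by simp only [hpp t]
  have hqi : IntervalIntegrable (fun t => p t - m) volume 0 T := hpi.sub intervalIntegrable_const
  have hqI : ∀ s t, IntervalIntegrable (fun t => p t - m) volume s t := fun s t =>
    (hpI s t).sub intervalIntegrable_const
  have hq0 : ∫ t in (0 : ℝ)..T, (p t - m) = 0 := by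
    rw [intervalIntegral.integral_sub hpi intervalIntegrable_const,
      intervalIntegral.integral_congr (g := g₁) fun t ht => hpg t (by
        rw [uIcc_of_le hT.le] at ht; exact ht.1), intervalIntegral.integral_const, hm, periodMean]
    simp only [smul_eq_mul]
    field_simp
    ring
  -- The primitive of a periodic function of mean zero stays between its extrema over one period.
  have hup := hq.integral_le_sSup_add_zsmul_of_pos hqi hT
  have hlo := hq.sInf_add_zsmul_le_integral_of_pos hqi hT
  simp only [hq0, smul_zero, add_zero] at hup hlo
  set U := sSup ((fun t => ∫ x in (0 : ℝ)..t, (p x - m)) '' Icc 0 T)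
  set V := sInf ((fun t => ∫ x in (0 : ℝ)..t, (p x - m)) '' Icc 0 T)
  obtain ⟨R, hR⟩ := (h.vanish.eventually (Metric.closedBall_mem_nhds 0 hε)).exists_forall_of_atTop
  -- The part of |g - p| above ε vanishes from R on and is integrable before, so its total integral
  -- is a constant independent of s and t.
  set e : ℝ → ℝ := fun t => max (|g t - p t| - ε) 0 with he
  have hgp : ∀ s t, 0 ≤ s → 0 ≤ t → IntervalIntegrable (fun t => g t - p t) volume s t :=
    fun s t hs ht => (h.intervalIntegrable hs ht).sub (hpI s t)
  have hei : ∀ s t, 0 ≤ s → 0 ≤ t → IntervalIntegrable e volume s t := fun s t hs ht => by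
    have h1 := (hgp s t hs ht).abs.sub (intervalIntegrable_const (c := ε))
    exact ⟨h1.1.sup (integrable_zero _ _ _), h1.2.sup (integrable_zero _ _ _)⟩
  have he0 : ∀ t, 0 ≤ e t := fun t => le_max_right _ _
  have heR : ∀ t, 0 ≤ t → R ≤ t → e t = 0 := fun t h0 ht => by
    refine max_eq_right ?_
    have h1 := hR t ht
    rw [dist_zero_right, Real.norm_eq_abs] at h1
    rw [hpg t h0, h.decomp t h0, add_sub_cancel_left]
    linarith
  set R' := max R 0 with hR'
  have hR'0 : 0 ≤ R' := le_max_right _ _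
  refine ⟨(U - V) + ∫ r in (0 : ℝ)..R', e r, fun s t hs hst => ?_⟩
  have ht : 0 ≤ t := hs.trans hst
  have h1 : (∫ r in s..t, g r) - m * (t - s) =
      (∫ r in s..t, (g r - p r)) + ∫ r in s..t, (p r - m) := by
    rw [← intervalIntegral.integral_add (hgp s t hs ht) (hqI s t)]
    simp only [sub_add_sub_cancel]
    rw [intervalIntegral.integral_sub (h.intervalIntegrable hs ht) intervalIntegrable_const,
      intervalIntegral.integral_const, smul_eq_mul, mul_comm]
  have h2 : |∫ r in s..t, (p r - m)| ≤ U - V := by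
    rw [← intervalIntegral.integral_interval_sub_left (hqI 0 t) (hqI 0 s), abs_le]
    constructor <;> linarith [hup t, hup s, hlo t, hlo s]
  have h3 : |∫ r in s..t, (g r - p r)| ≤ ε * (t - s) + ∫ r in (0 : ℝ)..R', e r := by
    refine (intervalIntegral.abs_integral_le_integral_abs hst).trans ?_
    have h4 : ∫ r in s..t, |g r - p r| ≤ ∫ r in s..t, (ε + e r) :=
      intervalIntegral.integral_mono_on hst (hgp s t hs ht).abs
        (intervalIntegrable_const.add (hei s t hs ht)) fun r _ => by
          have := le_max_left (|g r - p r| - ε) 0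
          simp only [he]; linarith
    rw [intervalIntegral.integral_add intervalIntegrable_const (hei s t hs ht),
      intervalIntegral.integral_const, smul_eq_mul, mul_comm] at h4
    have h5 : ∫ r in s..t, e r ≤ ∫ r in (0 : ℝ)..max t R', e r :=
      intervalIntegral.integral_mono_interval hs hst (le_max_left _ _)
        (Eventually.of_forall he0) (hei _ _ le_rfl (hR'0.trans (le_max_right _ _)))
    have h6 : ∫ r in R'..max t R', e r = 0 := by
      rw [intervalIntegral.integral_congr (g := fun _ => (0 : ℝ)), intervalIntegral.integral_zero]
      intro r hr
      rw [uIcc_of_le (le_max_right _ _)] at hr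
      exact heR r (hR'0.trans hr.1) ((le_max_left _ _).trans hr.1)
    have h7 := intervalIntegral.integral_add_adjacent_intervals (hei 0 R' le_rfl hR'0)
      (hei R' (max t R') hR'0 (hR'0.trans (le_max_right _ _)))
    linarith
  rw [h1]
  exact (abs_add_le _ _).trans (by linarith)

/-- Convolutions of a function of bounded local mass with a decaying exponential are bounded. -/
theorem integral_exp_mul_le {a : ℝ → ℝ} {r A : ℝ} (hr : 0 < r)
    (hai : ∀ s t, 0 ≤ s → 0 ≤ t → IntervalIntegrable a volume s t) (ha0 : ∀ t, 0 ≤ t → 0 ≤ a t)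
    (hA : ∀ t, 0 ≤ t → ∫ q in t..t + 1, a q ≤ A) {t : ℝ} (ht : 0 ≤ t) :
    ∫ q in (0 : ℝ)..t, Real.exp (-r * (t - q)) * a q ≤ A / (1 - Real.exp (-r)) := by
  have hρ : Real.exp (-r) < 1 := by rw [Real.exp_lt_one_iff]; linarith
  have hρ0 := Real.exp_pos (-r)
  have hA0 : 0 ≤ A := (intervalIntegral.integral_nonneg (by norm_num)
    fun q hq => ha0 q hq.1).trans (hA 0 le_rfl)
  have hAle : A ≤ A / (1 - Real.exp (-r)) := by
    rw [le_div_iff₀ (by linarith)]; nlinarith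
  have hcont : ∀ t : ℝ, Continuous fun q => Real.exp (-r * (t - q)) := fun t => by fun_prop
  have hI : ∀ t s s', 0 ≤ s → 0 ≤ s' →
      IntervalIntegrable (fun q => Real.exp (-r * (t - q)) * a q) volume s s' :=
    fun t s s' h h' => (hai s s' h h').continuousOn_mul (hcont t).continuousOn
  have hle : ∀ s t, 0 ≤ s → s ≤ t →
      ∫ q in s..t, Real.exp (-r * (t - q)) * a q ≤ ∫ q in s..t, a q := fun s t hs hst =>
    intervalIntegral.integral_mono_on hst (hI t s t hs (hs.trans hst))
      (hai s t hs (hs.trans hst)) fun q hq =>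
        mul_le_of_le_one_left (ha0 q (hs.trans hq.1)) (Real.exp_le_one_iff.2
          (by nlinarith [hq.2]))
  -- Induction over unit time steps: one step multiplies the convolution by e^{-r} and adds at most
  -- A, and A / (1 - e^{-r}) is the fixed point of x ↦ e^{-r} x + A.
  suffices H : ∀ n : ℕ, ∀ t : ℝ, 0 ≤ t → t ≤ n →
      ∫ q in (0 : ℝ)..t, Real.exp (-r * (t - q)) * a q ≤ A / (1 - Real.exp (-r)) by
    obtain ⟨n, hn⟩ := exists_nat_ge t
    exact H n t ht hn
  intro n
  induction n with
  | zero =>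
    intro t h0 h1
    have : t = 0 := le_antisymm (by simpa using h1) h0
    rw [this, intervalIntegral.integral_same]
    exact hA0.trans hAle
  | succ n ih =>
    intro t h0 h1
    rcases le_total t 1 with h | h
    · refine (hle 0 t le_rfl h0).trans (le_trans ?_ ((hA 0 le_rfl).trans hAle))
      refine intervalIntegral.integral_mono_interval le_rfl h0 (by simpa using h) ?_
        (hai _ _ le_rfl (by norm_num))
      exact (ae_restrict_iff' measurableSet_Ioc).2
        (Eventually.of_forall fun q hq => ha0 q hq.1.le)
    · push_cast at h1
      have h2 := ih (t - 1) (by linarith) (by linarith)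
      rw [← intervalIntegral.integral_add_adjacent_intervals (hI t 0 (t - 1) le_rfl (by linarith))
        (hI t (t - 1) t (by linarith) h0)]
      have h3 : ∫ q in (0 : ℝ)..(t - 1), Real.exp (-r * (t - q)) * a q = Real.exp (-r) *
          ∫ q in (0 : ℝ)..(t - 1), Real.exp (-r * (t - 1 - q)) * a q := by
        rw [← intervalIntegral.integral_const_mul]
        refine intervalIntegral.integral_congr fun q _ => ?_
        simp only [← mul_assoc, ← Real.exp_add]
        congr 2; ring
      have h4 := (hle (t - 1) t (by linarith) (by linarith)).trans
        (by simpa using hA (t - 1) (by linarith))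
      rw [h3]
      have h5 := mul_le_mul_of_nonneg_left h2 hρ0.le
      have h6 : A / (1 - Real.exp (-r)) = Real.exp (-r) * (A / (1 - Real.exp (-r))) + A := by
        have : 1 - Real.exp (-r) ≠ 0 := by linarith
        field_simp; ring
      linarith

/-! ### Tails of vectors and of solutions -/

/-- `tail x k = ∑_{i > k} x i`. -/
noncomputable def tail (x : ℕ → ℝ) (k : ℕ) : ℝ := ∑' i, x (k + 1 + i)

theorem sum_range_add_tail {x : ℕ → ℝ} (hx : Summable x) (k : ℕ) :
    ∑ i ∈ Finset.range (k + 1), x i + tail x k = ∑' i, x i := by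
  rw [← hx.sum_add_tsum_nat_add (k + 1), tail]
  simp only [add_comm]

theorem tail_eq_add_tail_succ {x : ℕ → ℝ} (hx : Summable x) (k : ℕ) :
    tail x k = x (k + 1) + tail x (k + 1) := by
  have h1 := sum_range_add_tail hx k
  have h2 := sum_range_add_tail hx (k + 1)
  rw [Finset.sum_range_succ] at h2
  linarith

theorem pre_tail_sub_tail {x : ℕ → ℝ} (hx : Summable x) (k : ℕ) :
    pre (∑' i, x i) (tail x) k - tail x k = x k := by
  cases k with
  | zero =>
    have := sum_range_add_tail hx 0
    simp only [zero_add, Finset.range_one, Finset.sum_singleton] at this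
    simp only [pre]; linarith
  | succ k => simp only [pre]; linarith [tail_eq_add_tail_succ hx k]

theorem tail_sub {x y : ℕ → ℝ} (hx : Summable x) (hy : Summable y) (k : ℕ) :
    tail (x - y) k = tail x k - tail y k := by
  have h1 := sum_range_add_tail hx k
  have h2 := sum_range_add_tail hy k
  have h3 := sum_range_add_tail (hx.sub hy) k
  rw [hx.tsum_sub hy, Finset.sum_sub_distrib] at h3
  have : tail (x - y) k = tail (fun i => x i - y i) k := rfl
  linarith

theorem tendsto_tail {x : ℕ → ℝ} (hx : Summable x) : Tendsto (tail x) atTop (𝓝 0) := by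
  have h : Tendsto (fun k => ∑' i, x i - ∑ i ∈ Finset.range (k + 1), x i) atTop
      (𝓝 (∑' i, x i - ∑' i, x i)) :=
    (hx.hasSum.tendsto_sum_nat.comp (tendsto_add_atTop_nat 1)).const_sub _
  rw [sub_self] at h
  exact h.congr fun k => by linarith [sum_range_add_tail hx k]

/-- The sum telescopes to the net flux between states k and k + 1; there is no flux below 0 because
μ_0 = 0. This is why the tail system is closed. -/
theorem sum_range_generator {lam mu : ℕ → ℝ} (hmu : mu 0 = 0) (a b : ℝ → ℝ) (t : ℝ)
    (x : ℕ → ℝ) (k : ℕ) :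
    ∑ i ∈ Finset.range (k + 1), generator lam mu a b t x i =
      mu (k + 1) * b t * x (k + 1) - lam k * a t * x k := by
  induction k with
  | zero => simp [generator, prev, hmu]; ring
  | succ k ih => rw [Finset.sum_range_succ, ih]; simp only [generator, prev]; ring

theorem probVectors_tail_nonneg {N : ℕ∞} {x : ℕ → ℝ} (hx : x ∈ probVectors N) (k : ℕ) :
    0 ≤ tail x k := tsum_nonneg fun _ => hx.1 _

theorem probVectors_tail_le_one {N : ℕ∞} {x : ℕ → ℝ} (hx : x ∈ probVectors N) (k : ℕ) :
    tail x k ≤ 1 := by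
  have h := sum_range_add_tail hx.2.2.summable k
  rw [hx.2.2.tsum_eq] at h
  have := Finset.sum_nonneg fun i (_ : i ∈ Finset.range (k + 1)) => hx.1 i
  linarith

theorem probVectors_tail_eq_zero {N : ℕ∞} {x : ℕ → ℝ} (hx : x ∈ probVectors N) {k : ℕ}
    (hk : N ≤ k) : tail x k = 0 := by
  have : ∀ i, x (k + 1 + i) = 0 := fun i => hx.2.1 _
    (hk.trans_lt (by exact_mod_cast (by omega : k < k + 1 + i)))
  simp [tail, this]

/-- The tails of a solution of the forward equation solve the tail system. -/
theorem IsForwardSolution.isTailSolution {N : ℕ∞} {lam mu : ℕ → ℝ} {a b : ℝ → ℝ} {s : ℝ}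
    {p : ℝ → ℕ → ℝ} (hp : IsForwardSolution N lam mu a b s p) (hmu : mu 0 = 0)
    (ha : ∀ t, s ≤ t → IntervalIntegrable a volume s t)
    (hb : ∀ t, s ≤ t → IntervalIntegrable b volume s t) :
    IsTailSolution N lam mu a b 1 s fun t => tail (p t) := by
  have hval : ∀ t, s ≤ t → ∀ k, tail (p t) k = 1 - ∑ i ∈ Finset.range (k + 1), p t i :=
    fun t ht k => by
      have h := sum_range_add_tail (hp.mem t ht).2.2.summable k
      rw [(hp.mem t ht).2.2.tsum_eq] at h
      linarith
  refine ⟨fun k => ?_, fun t ht k hk => ?_, fun t ht k => ?_, fun t ht k hk =>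
    probVectors_tail_eq_zero (hp.mem t ht) hk⟩
  · refine ContinuousOn.congr (f := fun t => 1 - ∑ i ∈ Finset.range (k + 1), p t i) ?_
      fun t ht => hval t ht k
    exact continuousOn_const.sub (continuousOn_finsetSum _ fun i _ => hp.cont i)
  · have hc : ∀ i, ContinuousOn (fun r => p r i) (uIcc s t) := fun i =>
      (hp.cont i).mono (by rw [uIcc_of_le ht]; exact Icc_subset_Ici_self)
    have hprev : ∀ i, ContinuousOn (fun r => prev (p r) i) (uIcc s t) := fun i => by
      cases i with
      | zero => exact continuousOn_const
      | succ i => exact hc i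
    have hgi : ∀ i, IntervalIntegrable (fun r => generator lam mu a b r (p r) i) volume s t :=
      fun i => ((((ha t ht).const_mul _).mul_continuousOn (hprev i)).sub
        ((((ha t ht).const_mul _).add ((hb t ht).const_mul _)).mul_continuousOn (hc i))).add
        (((hb t ht).const_mul _).mul_continuousOn (hc (i + 1)))
    have hsum : ∑ i ∈ Finset.range (k + 1), p t i = ∑ i ∈ Finset.range (k + 1), p s i
        + ∫ r in s..t, ∑ i ∈ Finset.range (k + 1), generator lam mu a b r (p r) i := by
      rw [intervalIntegral.integral_finsetSum fun i _ => hgi i, ← Finset.sum_add_distrib]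
      refine Finset.sum_congr rfl fun i hi => hp.eq t ht i ?_
      exact le_trans (by exact_mod_cast Nat.lt_succ_iff.1 (Finset.mem_range.1 hi)) hk.le
    have hneg : ∫ r in s..t, tailGenerator lam mu a b 1 r (tail (p r)) k =
        -∫ r in s..t, ∑ i ∈ Finset.range (k + 1), generator lam mu a b r (p r) i := by
      rw [← intervalIntegral.integral_neg]
      refine intervalIntegral.integral_congr fun r hr => ?_
      rw [uIcc_of_le ht] at hr
      have hm := hp.mem r hr.1
      have h1 := pre_tail_sub_tail hm.2.2.summable k
      rw [hm.2.2.tsum_eq] at h1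
      have h2 := tail_eq_add_tail_succ hm.2.2.summable k
      simp only [sum_range_generator hmu, tailGenerator, h1]
      rw [h2]; ring
    rw [hval t ht, hval s le_rfl, hsum, hneg]
    ring
  · rw [abs_of_nonneg (probVectors_tail_nonneg (hp.mem t ht) k)]
    exact probVectors_tail_le_one (hp.mem t ht) k

/-- The tails of the difference of two solutions of the forward equation solve the homogeneous
tail system. -/
theorem IsForwardSolution.isTailSolution_sub {N : ℕ∞} {lam mu : ℕ → ℝ} {a b : ℝ → ℝ} {s : ℝ}
    {p₁ p₂ : ℝ → ℕ → ℝ} (h₁ : IsForwardSolution N lam mu a b s p₁)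
    (h₂ : IsForwardSolution N lam mu a b s p₂) (hmu : mu 0 = 0)
    (ha : ∀ t, s ≤ t → IntervalIntegrable a volume s t)
    (hb : ∀ t, s ≤ t → IntervalIntegrable b volume s t) :
    IsTailSolution N lam mu a b 0 s fun t => tail (p₁ t - p₂ t) := by
  have t₁ := h₁.isTailSolution hmu ha hb
  have t₂ := h₂.isTailSolution hmu ha hb
  have hval : ∀ t, s ≤ t → ∀ k, tail (p₁ t - p₂ t) k = tail (p₁ t) k - tail (p₂ t) k :=
    fun t ht k => tail_sub (h₁.mem t ht).2.2.summable (h₂.mem t ht).2.2.summable k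
  refine ⟨fun k => ((t₁.cont k).sub (t₂.cont k)).congr fun t ht => hval t ht k,
    fun t ht k hk => ?_, fun t ht k => ?_, fun t ht k hk => ?_⟩
  · rw [hval t ht, hval s le_rfl, t₁.eq t ht k hk, t₂.eq t ht k hk, add_sub_add_comm,
      ← intervalIntegral.integral_sub (t₁.intervalIntegrable_tailGenerator ht (ha t ht) (hb t ht) k)
      (t₂.intervalIntegrable_tailGenerator ht (ha t ht) (hb t ht) k)]
    congr 1
    refine intervalIntegral.integral_congr fun r hr => ?_
    rw [uIcc_of_le ht] at hr
    have hp : pre 0 (tail (p₁ r - p₂ r)) k = pre 1 (tail (p₁ r)) k - pre 1 (tail (p₂ r)) k := by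
      cases k with
      | zero => simp [pre]
      | succ k => exact hval r hr.1 k
    simp only [tailGenerator, hp, hval r hr.1]
    ring
  · simp only [hval t ht]
    have a1 := probVectors_tail_nonneg (h₁.mem t ht) k
    have a2 := probVectors_tail_nonneg (h₂.mem t ht) k
    have b1 := probVectors_tail_le_one (h₁.mem t ht) k
    have b2 := probVectors_tail_le_one (h₂.mem t ht) k
    exact abs_le.2 ⟨by linarith, by linarith⟩
  · simp only [hval t ht, probVectors_tail_eq_zero (h₁.mem t ht) hk,
      probVectors_tail_eq_zero (h₂.mem t ht) hk, sub_zero]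

/-! ### Comparison of the norms -/

theorem sum_range_ofReal_abs_weight {w x : ℕ → ℝ} (hw : ∀ k, 0 ≤ w k) (n : ℕ) :
    ∑ k ∈ Finset.range (n + 1), ENNReal.ofReal |w k * x k| =
      ENNReal.ofReal (excessSum w 0 x n) := by
  rw [excessSum, ENNReal.ofReal_sum_of_nonneg fun k _ =>
    mul_nonneg (hw k) (excess_nonneg _ _)]
  simp only [abs_mul, excess_zero_left, abs_of_nonneg (hw _)]

/-- Bridge from real estimates of truncated sums to the extended norm; if the right-hand norm is
infinite, C > 0 makes the claim trivial. -/
theorem norm1D_le_mul {N : ℕ∞} {δ x y : ℕ → ℝ} {C : ℝ} (hC : 0 < C)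
    (hw : ∀ k, 0 ≤ weight N δ k)
    (h : ∀ S, (∀ m, excessSum (weight N δ) 0 (tail y) m ≤ S) →
      ∀ m, excessSum (weight N δ) 0 (tail x) m ≤ C * S) :
    norm1D N δ x ≤ ENNReal.ofReal C * norm1D N δ y := by
  by_cases hy : norm1D N δ y = ⊤
  · rw [hy, ENNReal.mul_top (by simpa using hC)]
    exact le_top
  have hS : ∀ m, excessSum (weight N δ) 0 (tail y) m ≤ (norm1D N δ y).toReal := fun m => by
    rw [← ENNReal.ofReal_le_iff_le_toReal hy, ← sum_range_ofReal_abs_weight hw]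
    exact ENNReal.sum_le_tsum _
  refine ENNReal.tsum_le_of_sum_range_le fun n => ?_
  calc _ ≤ ∑ k ∈ Finset.range (n + 1), ENNReal.ofReal |weight N δ k * tail x k| :=
        Finset.sum_le_sum_of_subset (Finset.range_mono (Nat.le_succ n))
    _ = ENNReal.ofReal (excessSum (weight N δ) 0 (tail x) n) := sum_range_ofReal_abs_weight hw n
    _ ≤ ENNReal.ofReal (C * (norm1D N δ y).toReal) := ENNReal.ofReal_le_ofReal (h _ hS n)
    _ = _ := by rw [ENNReal.ofReal_mul hC.le, ENNReal.ofReal_toReal hy]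

/-- By Tonelli, |x_j| is counted once with weight d_k for each k < j, that is, q_j in total. -/
theorem norm1D_le_normQ {N : ℕ∞} {δ x : ℕ → ℝ} (hw : ∀ k, 0 ≤ weight N δ k) :
    norm1D N δ x ≤ normQ N δ x := by
  have h1 : ∀ k, ENNReal.ofReal |weight N δ k * tail x k| ≤
      ∑' j, if k < j then ENNReal.ofReal (weight N δ k) * ENNReal.ofReal |x j| else 0 :=
    fun k => by
    rw [abs_mul, abs_of_nonneg (hw k), ENNReal.ofReal_mul (hw k)]
    have h2 : ENNReal.ofReal |tail x k| ≤ ∑' i, ENNReal.ofReal |x (k + 1 + i)| := by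
      simp only [← Real.enorm_eq_ofReal_abs]
      exact enorm_tsum_le_tsum_enorm
    refine (mul_le_mul_right h2 _).trans ?_
    rw [← ENNReal.tsum_mul_left]
    refine le_trans (le_of_eq ?_) (ENNReal.tsum_comp_le_tsum_of_injective
      (f := fun i => k + 1 + i) (add_right_injective _) _)
    refine tsum_congr fun i => ?_
    rw [if_pos (by omega)]
  refine (ENNReal.tsum_le_tsum h1).trans ?_
  rw [ENNReal.tsum_comm]
  refine ENNReal.tsum_le_tsum fun j => le_of_eq ?_
  rw [tsum_eq_sum (s := Finset.range j) fun k hk => if_neg (by simpa using hk), weightSum,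
    ENNReal.ofReal_mul (Finset.sum_nonneg fun k _ => hw k),
    ENNReal.ofReal_sum_of_nonneg fun k _ => hw k, Finset.sum_mul]
  exact Finset.sum_congr rfl fun k hk => if_pos (Finset.mem_range.1 hk)

/-- Zero total mass gives x_k = u_{k-1} - u_k with u_{-1} = 0, so each tail occurs twice; this is
the source of the 2. -/
theorem norm1_le_norm1D {N : ℕ∞} {δ x : ℕ → ℝ} {g : ℝ} (hg : 0 < g)
    (hw : ∀ k : ℕ, (k : ℕ∞) < N → g ≤ weight N δ k) (hx : Summable x) (hx0 : ∑' i, x i = 0)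
    (hxN : ∀ k : ℕ, N ≤ k → tail x k = 0) :
    norm1 x ≤ ENNReal.ofReal (2 / g) * norm1D N δ x := by
  have h1 : ∑' k, ENNReal.ofReal |tail x k| ≤ ENNReal.ofReal (1 / g) * norm1D N δ x := by
    rw [norm1D, norm1, ← ENNReal.tsum_mul_left]
    refine ENNReal.tsum_le_tsum fun k => ?_
    rw [← ENNReal.ofReal_mul (by positivity)]
    refine ENNReal.ofReal_le_ofReal ?_
    change |tail x k| ≤ 1 / g * |weight N δ k * tail x k|
    rcases lt_or_ge (k : ℕ∞) N with hk | hk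
    · have h := hw k hk
      rw [abs_mul, abs_of_pos (hg.trans_le h), ← mul_assoc]
      refine le_mul_of_one_le_left (abs_nonneg _) ?_
      rw [one_div, ← div_eq_inv_mul, one_le_div hg]
      exact h
    · simp [hxN k hk]
  have h2 : norm1 x ≤ ∑' k, ENNReal.ofReal |pre 0 (tail x) k| + ∑' k, ENNReal.ofReal |tail x k| := by
    rw [← ENNReal.tsum_add]
    refine ENNReal.tsum_le_tsum fun k => ?_
    rw [← ENNReal.ofReal_add (abs_nonneg _) (abs_nonneg _)]
    refine ENNReal.ofReal_le_ofReal ?_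
    have h := pre_tail_sub_tail hx k
    rw [hx0] at h
    rw [← h]
    exact abs_sub _ _
  have h3 : ∑' k, ENNReal.ofReal |pre 0 (tail x) k| = ∑' k, ENNReal.ofReal |tail x k| := by
    rw [tsum_eq_zero_add' ENNReal.summable]
    simp [pre]
  rw [h3, ← two_mul] at h2
  refine h2.trans ((mul_le_mul_right h1 2).trans (le_of_eq ?_))
  rw [← mul_assoc, show (2 : ℝ≥0∞) = ENNReal.ofReal 2 by simp, ← ENNReal.ofReal_mul (by norm_num),
    mul_one_div]

/-! ### The weights -/

theorem cases_of_one_le {N : ℕ∞} (h : 1 ≤ N) : N = ⊤ ∨ ∃ n : ℕ, N = ((n + 1 : ℕ) : ℕ∞) := by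
  induction N using ENat.recTopCoe with
  | top => exact Or.inl rfl
  | coe m =>
    have h' : 1 ≤ m := by exact_mod_cast h
    exact Or.inr ⟨m - 1, by rw [Nat.sub_add_cancel h']⟩

section Rates

variable {N : ℕ∞} {lam mu : ℕ → ℝ} {L M : ℝ}

theorem Rates.L_pos (h : Rates N lam mu L M) : 0 < L := by
  rcases cases_of_one_le h.one_le with hN | ⟨n, hN⟩
  · exact (h.infinite hN).2.1
  · rw [(h.finite n hN).2.1]
    exact h.lam_pos n (by rw [hN]; exact_mod_cast Nat.lt_succ_self n)

theorem Rates.M_pos (h : Rates N lam mu L M) : 0 < M := by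
  rcases cases_of_one_le h.one_le with hN | ⟨n, hN⟩
  · exact (h.infinite hN).2.2.2
  · rw [(h.finite n hN).2.2]
    exact h.mu_pos (n + 1) (by omega) hN.ge

theorem Rates.lam_nonneg (h : Rates N lam mu L M) (k : ℕ) (hk : (k : ℕ∞) ≤ N) : 0 ≤ lam k := by
  rcases hk.lt_or_eq with hk | hk
  · exact (h.lam_pos k hk).le
  · rcases cases_of_one_le h.one_le with hN | ⟨n, hN⟩
    · exact absurd (hk.trans hN) (ENat.natCast_ne_top k)
    · have : k = n + 1 := by exact_mod_cast hk.trans hN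
      rw [this, (h.finite n hN).1]

theorem Rates.mu_succ_pos (h : Rates N lam mu L M) (k : ℕ) (hk : (k : ℕ∞) < N) :
    0 < mu (k + 1) :=
  h.mu_pos (k + 1) (by omega) (by exact_mod_cast Order.add_one_le_of_lt hk)

theorem Rates.mu_nonneg (h : Rates N lam mu L M) (k : ℕ) (hk : (k : ℕ∞) ≤ N) : 0 ≤ mu k := by
  cases k with
  | zero => exact h.mu_zero.ge
  | succ k => exact (h.mu_pos _ (by omega) hk).le

/-- A nonnegative number below the larger root of a quadratic polynomial with roots of opposite
signs. -/
theorem mul_sq_le_of_le_root {D X Y c : ℝ} (hD : 0 < D) (hY : 0 ≤ Y) (hc : 0 ≤ c)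
    (h : c ≤ (X + √(X ^ 2 + 4 * D * Y)) / (2 * D)) : D * c ^ 2 ≤ X * c + Y := by
  rw [le_div_iff₀ (by positivity)] at h
  -- Left of the vertex of the parabola the inequality is immediate; right of it the bound by the
  -- root may be squared.
  rcases le_or_gt (2 * D * c) X with h1 | h1
  · nlinarith [mul_nonneg hD.le (sq_nonneg c), mul_le_mul_of_nonneg_right h1 hc]
  · have h2 : 2 * D * c - X ≤ √(X ^ 2 + 4 * D * Y) := by linarith
    have h3 := Real.sq_sqrt (show 0 ≤ X ^ 2 + 4 * D * Y by positivity)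
    have h4 : (2 * D * c - X) ^ 2 ≤ X ^ 2 + 4 * D * Y := by
      rw [← h3]; exact pow_le_pow_left₀ (by linarith) h2 2
    have h5 : 0 ≤ 4 * D * (X * c + Y - D * c ^ 2) := by nlinarith
    have := nonneg_of_mul_nonneg_right h5 (by positivity)
    linarith

/-- The ratios of consecutive weights. -/
noncomputable def ratio (lam : ℕ → ℝ) (e : ℝ) : ℕ → ℝ
  | 0 => 1
  | k + 1 => (lam k + e) / lam (k + 1)

theorem Rates.ratio_pos (h : Rates N lam mu L M) {e : ℝ} (he : 0 < e) (k : ℕ)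
    (hk : (k : ℕ∞) < N) : 0 < ratio lam e k := by
  cases k with
  | zero => exact one_pos
  | succ k =>
    have hk' : (k : ℕ∞) ≤ N := le_trans (by exact_mod_cast Nat.le_succ k) hk.le
    have := h.lam_nonneg k hk'
    exact div_pos (by linarith) (h.lam_pos _ hk)

theorem Rates.tendsto_ratio (h : Rates ⊤ lam mu L M) (e : ℝ) :
    Tendsto (ratio lam e) atTop (𝓝 ((L + e) / L)) := by
  have hl := (h.infinite rfl).1
  refine (tendsto_add_atTop_iff_nat 1).1 ?_
  exact (hl.add_const e).div (hl.comp (tendsto_add_atTop_nat 1)) h.L_pos.ne'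

/-- Birth part: `ratio` is built so that λ_k - δ_{k+1} λ_{k+1} = -cΔL. Death part: clearing
denominators in μ_{k+1} - μ_k / δ_k ≥ cM gives the quadratic inequality in c whose larger root is
f_k. At k = 0 the condition is cM ≤ μ_1. -/
theorem Rates.le_alpha (h : Rates N lam mu L M) {a b : ℝ → ℝ} {Δ c t : ℝ} (hΔ : 0 < Δ)
    (hc : 0 < c) {k : ℕ} (hk : (k : ℕ∞) < N)
    (ha : 0 ≤ a t) (hb : 0 ≤ b t)
    (hprod : 0 ≤ prev lam k * mu (k + 1) - lam k * mu k)
    (hcmu : c < mu (k + 1) / M) (hcf : c ≤ f lam mu L M Δ k) :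
    c * (M * b t - Δ * L * a t) ≤ alpha lam mu a b (ratio lam (c * Δ * L)) k t := by
  have hL := h.L_pos
  have hM := h.M_pos
  have he : 0 < c * Δ * L := by positivity
  have h1 : ratio lam (c * Δ * L) (k + 1) * lam (k + 1) ≤ lam k + c * Δ * L := by
    -- At the upper end of a finite state space λ_N = 0, and only an inequality holds.
    by_cases h0 : lam (k + 1) = 0
    · rw [h0, mul_zero]
      linarith [h.lam_pos k hk]
    · simp only [ratio]
      rw [div_mul_cancel₀ _ h0]
  have h2 : (ratio lam (c * Δ * L) k)⁻¹ * mu k ≤ mu (k + 1) - c * M := by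
    cases k with
    | zero =>
      rw [h.mu_zero, mul_zero]
      have := (lt_div_iff₀ hM).1 hcmu
      linarith
    | succ j =>
      have hj : 0 ≤ lam j := h.lam_nonneg j (le_trans (by exact_mod_cast Nat.le_succ j) hk.le)
      have hq := mul_sq_le_of_le_root (D := Δ * L * M)
        (X := Δ * L * mu (j + 1 + 1) - prev lam (j + 1) * M)
        (Y := prev lam (j + 1) * mu (j + 1 + 1) - lam (j + 1) * mu (j + 1)) (c := c)
        (by positivity) hprod hc.le (by
          rw [show 2 * (Δ * L * M) = 2 * Δ * L * M by ring,
            show 4 * (Δ * L * M) = 4 * Δ * L * M by ring]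
          exact hcf)
      simp only [ratio, prev] at *
      rw [inv_div, div_mul_eq_mul_div, div_le_iff₀ (by linarith)]
      linarith
  have h3 := mul_le_mul_of_nonneg_right h1 ha
  have h4 := mul_le_mul_of_nonneg_right h2 hb
  unfold alpha
  linarith

end Rates

/-! ### Products of the ratios: positivity, growth and the column condition -/

section Weight

variable {N : ℕ∞} {δ : ℕ → ℝ}

theorem weight_of_lt {k : ℕ} (hk : (k : ℕ∞) < N) :
    weight N δ k = ∏ i ∈ Finset.range k, δ (i + 1) := if_pos hk

theorem weight_of_le {k : ℕ} (hk : N ≤ k) : weight N δ k = 0 := if_neg hk.not_gt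

theorem weight_zero (hN : 1 ≤ N) : weight N δ 0 = 1 := by
  rw [weight_of_lt (by exact_mod_cast (zero_lt_one.trans_le hN)), Finset.range_zero,
    Finset.prod_empty]

theorem weight_succ {k : ℕ} (hk : ((k + 1 : ℕ) : ℕ∞) < N) :
    weight N δ (k + 1) = δ (k + 1) * weight N δ k := by
  rw [weight_of_lt hk, weight_of_lt (lt_trans (by exact_mod_cast Nat.lt_succ_self k) hk),
    Finset.prod_range_succ, mul_comm]

theorem weight_pos (hδ : ∀ k : ℕ, (k : ℕ∞) < N → 0 < δ k) (k : ℕ) (hk : (k : ℕ∞) < N) :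
    0 < weight N δ k := by
  rw [weight_of_lt hk]
  refine Finset.prod_pos fun i hi => hδ _ (lt_of_le_of_lt ?_ hk)
  exact_mod_cast Finset.mem_range.1 hi

theorem weight_nonneg (hδ : ∀ k : ℕ, (k : ℕ∞) < N → 0 < δ k) (k : ℕ) : 0 ≤ weight N δ k := by
  rcases lt_or_ge (k : ℕ∞) N with hk | hk
  · exact (weight_pos hδ k hk).le
  · exact (weight_of_le hk).ge

/-- Multiplication by d_k turns δ_{k+1} into d_{k+1} and δ_k⁻¹ into d_{k-1}, the form needed for
summation by columns. -/
theorem mul_weight_le_of_le_alpha {lam mu : ℕ → ℝ} {L M : ℝ} (h : Rates N lam mu L M)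
    (hδ : ∀ k : ℕ, (k : ℕ∞) < N → 0 < δ k) {a b : ℝ → ℝ} {t β : ℝ} {k : ℕ}
    (hk : (k : ℕ∞) < N) (hβ : β ≤ alpha lam mu a b δ k t) :
    β * weight N δ k ≤ weight N δ k * (lam k * a t + mu (k + 1) * b t)
      - weight N δ (k + 1) * (lam (k + 1) * a t) - prev (weight N δ) k * (mu k * b t) := by
  have hw := weight_pos hδ k hk
  have h1 : weight N δ (k + 1) * (lam (k + 1) * a t) =
      weight N δ k * (δ (k + 1) * (lam (k + 1) * a t)) := by
    rcases lt_or_ge ((k + 1 : ℕ) : ℕ∞) N with hk1 | hk1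
    · rw [weight_succ hk1]; ring
    -- Here k = N - 1: `weight` is zero at N by convention, in agreement with λ_N = 0.
    · rcases cases_of_one_le h.one_le with hN | ⟨n, hN⟩
      · exact absurd (hN ▸ hk1) (not_le.2 (ENat.natCast_lt_top _))
      · have h2 : k < n + 1 := by rw [hN] at hk; exact_mod_cast hk
        have h3 : n + 1 ≤ k + 1 := by rw [hN] at hk1; exact_mod_cast hk1
        have : k = n := by omega
        rw [this, (h.finite n hN).1]; ring
  have h2 : prev (weight N δ) k * (mu k * b t) = weight N δ k * ((δ k)⁻¹ * (mu k * b t)) := by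
    cases k with
    | zero => simp [prev, h.mu_zero]
    | succ k =>
      have := (hδ _ hk).ne'
      simp only [prev]
      rw [weight_succ hk]
      field_simp
  rw [h1, h2]
  have := mul_le_mul_of_nonneg_right hβ hw.le
  unfold alpha at this
  linarith

theorem tendsto_weight_atTop {ρ : ℝ} (hδ : ∀ k, 0 < δ k) (hρ : 1 < ρ)
    (h : Tendsto δ atTop (𝓝 ρ)) : Tendsto (weight ⊤ δ) atTop atTop := by
  obtain ⟨q, hq1, hqρ⟩ := exists_between hρ
  obtain ⟨n, hn⟩ := (h.eventually (lt_mem_nhds hqρ)).exists_forall_of_atTop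
  have hpos := fun k => weight_pos (N := ⊤) (fun k _ => hδ k) k (ENat.natCast_lt_top k)
  refine (tendsto_add_atTop_iff_nat n).1 (tendsto_atTop_of_geom_le (c := q)
    (by simpa using hpos n) hq1 fun k => ?_)
  rw [show k + 1 + n = k + n + 1 by ring, weight_succ (ENat.natCast_lt_top _)]
  exact mul_le_mul_of_nonneg_right (hn _ (by omega)).le (hpos _).le

theorem exists_forall_le_weight (hN : 1 ≤ N) (hδ : ∀ k : ℕ, (k : ℕ∞) < N → 0 < δ k)
    (h : N = ⊤ → Tendsto (weight N δ) atTop atTop) :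
    ∃ g, 0 < g ∧ ∀ k : ℕ, (k : ℕ∞) < N → g ≤ weight N δ k := by
  have key : ∀ n : ℕ, (n : ℕ∞) < N → ∃ g, 0 < g ∧ ∀ k ≤ n, g ≤ weight N δ k := fun n hn => by
    obtain ⟨j, hj, hmin⟩ := Finset.exists_min_image (Finset.range (n + 1)) (weight N δ)
      ⟨0, by simp⟩
    have hjn : (j : ℕ∞) < N :=
      lt_of_le_of_lt (by exact_mod_cast Nat.lt_succ_iff.1 (Finset.mem_range.1 hj)) hn
    exact ⟨_, weight_pos hδ j hjn, fun k hk => hmin k (Finset.mem_range.2 (by omega))⟩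
  rcases cases_of_one_le hN with rfl | ⟨n, rfl⟩
  · obtain ⟨n, hn⟩ := ((h rfl).eventually_ge_atTop 1).exists_forall_of_atTop
    obtain ⟨g, hg0, hg⟩ := key n (ENat.natCast_lt_top n)
    refine ⟨min g 1, lt_min hg0 one_pos, fun k _ => ?_⟩
    rcases le_total k n with hk | hk
    · exact (min_le_left _ _).trans (hg k hk)
    · exact (min_le_right _ _).trans (hn k hk)
  · obtain ⟨g, hg0, hg⟩ := key n (by exact_mod_cast Nat.lt_succ_self n)
    exact ⟨g, hg0, fun k hk => hg k (Nat.lt_succ_iff.1 (by exact_mod_cast hk))⟩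

theorem weightInf_le (hδ : ∀ k : ℕ, (k : ℕ∞) < N → 0 < δ k) (k : ℕ) (hk : (k : ℕ∞) < N) :
    weightInf N δ ≤ weight N δ k :=
  csInf_le ⟨0, by rintro _ ⟨j, -, rfl⟩; exact weight_nonneg hδ j⟩ (mem_image_of_mem _ hk)

theorem weightInf_pos (hN : 1 ≤ N) (hδ : ∀ k : ℕ, (k : ℕ∞) < N → 0 < δ k)
    (h : N = ⊤ → Tendsto (weight N δ) atTop atTop) : 0 < weightInf N δ := by
  obtain ⟨g, hg0, hg⟩ := exists_forall_le_weight hN hδ h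
  refine hg0.trans_le (le_csInf ⟨_, mem_image_of_mem _ (?_ : ((0 : ℕ) : ℕ∞) < N)⟩ ?_)
  · exact_mod_cast (zero_lt_one.trans_le hN)
  · rintro _ ⟨k, hk, rfl⟩
    exact hg k hk

/-- If the ratios converge to a positive limit, the weights grow and decay at bounded rates. -/
theorem exists_weight_ratio_bound {ρ : ℝ} (hδ : ∀ k, 0 < δ k) (hρ : 0 < ρ)
    (h : Tendsto δ atTop (𝓝 ρ)) :
    ∃ R, 2 ≤ R ∧ (∀ k, weight ⊤ δ (k + 1) ≤ R * weight ⊤ δ k) ∧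
      ∀ k, weight ⊤ δ k ≤ R * weight ⊤ δ (k + 1) := by
  obtain ⟨R₁, h₁⟩ := h.bddAbove_range
  obtain ⟨R₂, h₂⟩ := (h.inv₀ hρ.ne').bddAbove_range
  have hw := fun k => weight_pos (N := ⊤) (fun k _ => hδ k) k (ENat.natCast_lt_top k)
  refine ⟨max 2 (max R₁ R₂), le_max_left _ _, fun k => ?_, fun k => ?_⟩
  · rw [weight_succ (ENat.natCast_lt_top _)]
    refine mul_le_mul_of_nonneg_right ?_ (hw k).le
    exact (h₁ (mem_range_self _)).trans ((le_max_left _ _).trans (le_max_right _ _))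
  · have h3 : (δ (k + 1))⁻¹ ≤ max 2 (max R₁ R₂) :=
      (h₂ (mem_range_self (k + 1))).trans ((le_max_right _ _).trans (le_max_right _ _))
    refine le_trans (le_of_eq ?_) (mul_le_mul_of_nonneg_right h3 (hw (k + 1)).le)
    rw [weight_succ (ENat.natCast_lt_top _), inv_mul_cancel_left₀ (hδ _).ne']

end Weight

/-! ### Merging of solutions -/

/-- Rates, coefficients, ratios of weights and a lower bound `β` for the functions `alpha`, as
needed for the weighted estimates. -/
structure Admissible (N : ℕ∞) (lam mu : ℕ → ℝ) (L M : ℝ) (a b : ℝ → ℝ) (δ : ℕ → ℝ)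
    (β : ℝ → ℝ) : Prop where
  rates : Rates N lam mu L M
  integrable_a : ∀ s t, 0 ≤ s → 0 ≤ t → IntervalIntegrable a volume s t
  integrable_b : ∀ s t, 0 ≤ s → 0 ≤ t → IntervalIntegrable b volume s t
  integrable_β : ∀ s t, 0 ≤ s → 0 ≤ t → IntervalIntegrable β volume s t
  a_nonneg : ∀ t, 0 ≤ t → 0 ≤ a t
  b_nonneg : ∀ t, 0 ≤ t → 0 ≤ b t
  ratio_pos : ∀ k : ℕ, (k : ℕ∞) < N → 0 < δ k
  tendsto_ratio : N = ⊤ → ∃ ρ, 1 < ρ ∧ Tendsto δ atTop (𝓝 ρ)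
  le_alpha : ∀ t, 0 ≤ t → ∀ k : ℕ, (k : ℕ∞) < N → β t ≤ alpha lam mu a b δ k t

section Merging

variable {N : ℕ∞} {lam mu : ℕ → ℝ} {L M : ℝ} {a b : ℝ → ℝ} {δ : ℕ → ℝ} {β : ℝ → ℝ}

theorem Admissible.tendsto_weight (h : Admissible N lam mu L M a b δ β) (hN : N = ⊤) :
    Tendsto (weight N δ) atTop atTop := by
  subst hN
  obtain ⟨ρ, hρ, hlim⟩ := h.tendsto_ratio rfl
  exact tendsto_weight_atTop (fun k => h.ratio_pos k (ENat.natCast_lt_top k)) hρ hlim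

theorem Admissible.weightInf_pos (h : Admissible N lam mu L M a b δ β) : 0 < weightInf N δ :=
  BDP.weightInf_pos h.rates.one_le h.ratio_pos h.tendsto_weight

theorem Admissible.excessSum_mul_exp_le (h : Admissible ⊤ lam mu L M a b δ β) {η s t κ S : ℝ}
    {u : ℝ → ℕ → ℝ} (hu : IsTailSolution ⊤ lam mu a b η s u) (hs : 0 ≤ s) (hst : s ≤ t)
    (hκ : 0 ≤ κ) (hS : ∀ m, excessSum (weight ⊤ δ) κ (u s) m ≤ S) (m : ℕ) :
    excessSum (weight ⊤ δ) κ (u t) m * Real.exp (∫ r in s..t, β r) ≤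
      S + lam 0 * |η| * ∫ r in s..t, Real.exp (∫ q in s..r, β q) * a r := by
  have ht := hs.trans hst
  have hlt : ∀ k : ℕ, (k : ℕ∞) < ⊤ := ENat.natCast_lt_top
  obtain ⟨ρ, hρ, hlim⟩ := h.tendsto_ratio rfl
  obtain ⟨R, hR, hR1, hR2⟩ := exists_weight_ratio_bound (fun k => h.ratio_pos k (hlt k))
    (zero_lt_one.trans hρ) hlim
  obtain ⟨hl, -, hm, -⟩ := h.rates.infinite rfl
  obtain ⟨Λ₁, h₁⟩ := hl.bddAbove_range
  obtain ⟨Λ₂, h₂⟩ := hm.bddAbove_range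
  have := hu.excessSum_mul_exp_le_of_top hst (h.integrable_a s t hs ht) (h.integrable_b s t hs ht)
    (fun r hr => h.a_nonneg r (hs.trans hr)) (fun r hr => h.b_nonneg r (hs.trans hr)) hκ
    (fun k => h.rates.lam_nonneg k (hlt k).le) (fun k => h.rates.mu_nonneg k (hlt k).le)
    (fun k => (h₁ (mem_range_self k)).trans (le_max_left Λ₁ Λ₂))
    (fun k => (h₂ (mem_range_self k)).trans (le_max_right Λ₁ Λ₂))
    (fun k => weight_pos h.ratio_pos k (hlt k)) hR hR1 hR2 hS (h.integrable_β s t hs ht)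
    (fun r hr k => mul_weight_le_of_le_alpha h.rates h.ratio_pos (hlt k)
      (h.le_alpha r (hs.trans hr) k (hlt k))) m
  rwa [weight_zero le_top, one_mul] at this

theorem Admissible.isTailSolution (h : Admissible N lam mu L M a b δ β) {s : ℝ}
    {p : ℝ → ℕ → ℝ} (hs : 0 ≤ s) (hp : IsForwardSolution N lam mu a b s p) :
    IsTailSolution N lam mu a b 1 s fun t => tail (p t) :=
  hp.isTailSolution h.rates.mu_zero (fun t ht => h.integrable_a s t hs (hs.trans ht))
    fun t ht => h.integrable_b s t hs (hs.trans ht)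

theorem Admissible.isTailSolution_sub (h : Admissible N lam mu L M a b δ β) {s : ℝ}
    {p₁ p₂ : ℝ → ℕ → ℝ} (hs : 0 ≤ s) (h₁ : IsForwardSolution N lam mu a b s p₁)
    (h₂ : IsForwardSolution N lam mu a b s p₂) :
    IsTailSolution N lam mu a b 0 s fun t => tail (p₁ t - p₂ t) :=
  h₁.isTailSolution_sub h₂ h.rates.mu_zero
    (fun t ht => h.integrable_a s t hs (hs.trans ht))
    fun t ht => h.integrable_b s t hs (hs.trans ht)

theorem Admissible.excessSum_sub_mul_exp_le (h : Admissible N lam mu L M a b δ β) {s t S : ℝ}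
    {p₁ p₂ : ℝ → ℕ → ℝ} (hs : 0 ≤ s) (hst : s ≤ t) (h₁ : IsForwardSolution N lam mu a b s p₁)
    (h₂ : IsForwardSolution N lam mu a b s p₂)
    (hS : ∀ m, excessSum (weight N δ) 0 (tail (p₁ s - p₂ s)) m ≤ S) (m : ℕ) :
    excessSum (weight N δ) 0 (tail (p₁ t - p₂ t)) m * Real.exp (∫ r in s..t, β r) ≤ S := by
  have hu := h.isTailSolution_sub hs h₁ h₂
  have ht := hs.trans hst
  rcases cases_of_one_le h.rates.one_le with rfl | ⟨n, rfl⟩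
  · simpa using h.excessSum_mul_exp_le hu hs hst le_rfl hS m
  · have hw := weight_nonneg h.ratio_pos
    have hlt : ∀ k ≤ n, (k : ℕ∞) < ((n + 1 : ℕ) : ℕ∞) := fun k hk => by
      exact_mod_cast Nat.lt_succ_of_le hk
    have h3 := hu.excessSum_mul_exp_le_of_finite hst (h.integrable_a s t hs ht)
      (h.integrable_b s t hs ht) (fun r hr => h.a_nonneg r (hs.trans hr))
      (fun r hr => h.b_nonneg r (hs.trans hr))
      (fun k hk => h.rates.lam_nonneg k (by exact_mod_cast hk))
      (fun k hk => (h.rates.mu_succ_pos k (hlt k hk)).le) hw (h.integrable_β s t hs ht)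
      fun r hr k hk => mul_weight_le_of_le_alpha h.rates h.ratio_pos (hlt k hk)
        (h.le_alpha r (hs.trans hr) k (hlt k hk))
    -- Weights vanish from N on, so sums beyond `n` add nothing.
    have h4 : excessSum (weight ((n + 1 : ℕ) : ℕ∞) δ) 0 (tail (p₁ t - p₂ t)) (max m n) =
        excessSum (weight ((n + 1 : ℕ) : ℕ∞) δ) 0 (tail (p₁ t - p₂ t)) n := by
      symm
      refine Finset.sum_subset (Finset.range_mono (by omega)) fun k _ hk => ?_
      have hk' : n + 1 ≤ k := by simpa using hk
      rw [weight_of_le (by exact_mod_cast hk'), zero_mul]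
    have h5 := excessSum_mono hw 0 (tail (p₁ t - p₂ t)) (le_max_left m n)
    rw [h4] at h5
    exact (mul_le_mul_of_nonneg_right h5 (Real.exp_pos _).le).trans (h3.trans (hS n))

theorem Admissible.exponentialMerging (h : Admissible N lam mu L M a b δ β) {K r : ℝ}
    (hK : 0 < K) (hexp : ∀ s t : ℝ, 0 ≤ s → s ≤ t →
      Real.exp (-∫ u in s..t, β u) ≤ K * Real.exp (-r * (t - s))) :
    ExponentialMerging N lam mu a b δ K r := by
  intro s t hs hst p₁ p₂ h₁ h₂
  have hw := weight_nonneg h.ratio_pos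
  have hC : 0 < K * Real.exp (-r * (t - s)) := mul_pos hK (Real.exp_pos _)
  have hg := h.weightInf_pos
  have hD : norm1D N δ (p₁ t - p₂ t)
      ≤ ENNReal.ofReal (K * Real.exp (-r * (t - s))) * norm1D N δ (p₁ s - p₂ s) := by
    refine norm1D_le_mul hC hw fun S hS m => ?_
    have h3 := h.excessSum_sub_mul_exp_le hs hst h₁ h₂ hS m
    have hS0 : 0 ≤ S := le_trans (Finset.sum_nonneg fun k _ =>
      mul_nonneg (hw k) (excess_nonneg _ _)) (hS 0)
    rw [← le_div_iff₀ (Real.exp_pos _), div_eq_inv_mul, ← Real.exp_neg] at h3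
    exact h3.trans (mul_le_mul_of_nonneg_right (hexp s t hs hst) hS0)
  refine ⟨hD, ?_⟩
  have m₁ := h₁.mem t hst
  have m₂ := h₂.mem t hst
  have h4 : norm1 (p₁ t - p₂ t) ≤
      ENNReal.ofReal (2 / weightInf N δ) * norm1D N δ (p₁ t - p₂ t) := by
    refine norm1_le_norm1D hg (weightInf_le h.ratio_pos) (m₁.2.2.summable.sub m₂.2.2.summable) ?_
      fun k hk => (h.isTailSolution_sub hs h₁ h₂).eq_zero t hst k hk
    have := m₁.2.2.sub m₂.2.2
    rw [sub_self] at this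
    exact this.tsum_eq
  calc norm1 (p₁ t - p₂ t)
      ≤ ENNReal.ofReal (2 / weightInf N δ) * (ENNReal.ofReal (K * Real.exp (-r * (t - s))) *
        normQ N δ (p₁ s - p₂ s)) :=
        h4.trans (mul_le_mul_right (hD.trans (mul_le_mul_right (norm1D_le_normQ hw) _)) _)
    _ = ENNReal.ofReal (2 / weightInf N δ * (K * Real.exp (-r * (t - s)))) *
        normQ N δ (p₁ s - p₂ s) := by
        rw [← mul_assoc, ← ENNReal.ofReal_mul (by positivity)]
    _ ≤ _ := by
        refine mul_le_mul_left (ENNReal.ofReal_le_ofReal (mul_le_mul_of_nonneg_right ?_ hC.le)) _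
        -- The argument gives 2 in place of the stated 4.
        gcongr
        norm_num

theorem normQ_lt_top_of_finite {n : ℕ} {x : ℕ → ℝ} (hx : ∀ k, n < k → x k = 0) :
    normQ N δ x < ⊤ := by
  rw [normQ, tsum_eq_sum (s := Finset.range (n + 1)) fun k hk => by
    rw [hx k (by simpa using hk)]; simp]
  exact ENNReal.sum_lt_top.2 fun _ _ => ENNReal.ofReal_lt_top

theorem weaklyErgodic_of_exponentialMerging {n : ℕ} {K r : ℝ} (hr : 0 < r)
    (h : ExponentialMerging (n : ℕ∞) lam mu a b δ K r) :
    WeaklyErgodic (n : ℕ∞) lam mu a b := by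
  intro p₁ p₂ h₁ h₂
  have hQ : normQ (n : ℕ∞) δ (p₁ 0 - p₂ 0) < ⊤ := normQ_lt_top_of_finite (n := n) fun k hk => by
    have hk' : (n : ℕ∞) < k := by exact_mod_cast hk
    simp [(h₁.mem 0 le_rfl).2.1 k hk', (h₂.mem 0 le_rfl).2.1 k hk']
  have hlim : Tendsto (fun t : ℝ => ENNReal.ofReal (4 / weightInf n δ *
      (K * Real.exp (-r * (t - 0)))) * normQ n δ (p₁ 0 - p₂ 0)) atTop (𝓝 0) := by
    have h1 : Tendsto (fun t : ℝ => Real.exp (-r * (t - 0))) atTop (𝓝 0) := by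
      refine Real.tendsto_exp_atBot.comp ?_
      simp only [sub_zero]
      exact tendsto_id.const_mul_atTop_of_neg (neg_neg_of_pos hr)
    have h2 := ENNReal.tendsto_ofReal ((h1.const_mul K).const_mul (4 / weightInf n δ))
    rw [mul_zero, mul_zero, ENNReal.ofReal_zero] at h2
    simpa using ENNReal.Tendsto.mul_const h2 (Or.inr hQ.ne)
  refine tendsto_of_tendsto_of_tendsto_of_le_of_le' tendsto_const_nhds hlim
    (Eventually.of_forall fun _ => zero_le) ?_
  filter_upwards [eventually_ge_atTop 0] with t ht
  exact (h 0 t le_rfl ht p₁ p₂ h₁ h₂).2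

/-! ### Weak ergodicity on an infinite state space -/

/-- Only finitely many terms of a null sequence exceed κ > 0, so the excess sum is finite for any
weights; no moment condition on the initial law is needed. -/
theorem exists_excessSum_le_of_tendsto_zero {w x : ℕ → ℝ} {κ : ℝ} (hw : ∀ k, 0 ≤ w k)
    (hκ : 0 < κ) (hx : Tendsto x atTop (𝓝 0)) : ∃ S, 0 ≤ S ∧ ∀ m, excessSum w κ x m ≤ S := by
  obtain ⟨n, hn⟩ := (hx.eventually (Metric.closedBall_mem_nhds 0 hκ)).exists_forall_of_atTop
  refine ⟨excessSum w κ x n, Finset.sum_nonneg fun k _ => mul_nonneg (hw k) (excess_nonneg _ _),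
    fun m => (excessSum_mono hw κ x (le_max_left m n)).trans (le_of_eq ?_)⟩
  symm
  refine Finset.sum_subset (Finset.range_mono (by omega)) fun k _ hk => ?_
  have h1 := hn k (by have : n + 1 ≤ k := by simpa using hk
                      omega)
  rw [dist_zero_right, Real.norm_eq_abs] at h1
  rw [excess, max_eq_right (by linarith), mul_zero]

theorem norm1_sub_le_of_probVectors {x y : ℕ → ℝ} (hx : x ∈ probVectors N)
    (hy : y ∈ probVectors N) (n : ℕ) :
    norm1 (x - y) ≤
      ENNReal.ofReal (∑ i ∈ Finset.range (n + 1), |(x - y) i| + (tail x n + tail y n)) := by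
  have hxs := hx.2.2.summable
  have hys := hy.2.2.summable
  have hle : ∀ i, |(x - y) i| ≤ x i + y i := fun i => by
    rw [Pi.sub_apply]
    exact (abs_sub _ _).trans (by rw [abs_of_nonneg (hx.1 i), abs_of_nonneg (hy.1 i)])
  have hs : Summable fun i => |(x - y) i| :=
    Summable.of_nonneg_of_le (fun _ => abs_nonneg _) hle (hxs.add hys)
  rw [norm1, ← ENNReal.ofReal_tsum_of_nonneg (fun _ => abs_nonneg _) hs,
    ← sum_range_add_tail hs n]
  have htail : ∀ {z : ℕ → ℝ}, Summable z → Summable fun i => z (n + 1 + i) := fun hz =>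
    hz.comp_injective (add_right_injective (n + 1))
  refine ENNReal.ofReal_le_ofReal (add_le_add le_rfl ?_)
  rw [tail, tail, tail, ← Summable.tsum_add (htail hxs) (htail hys)]
  exact Summable.tsum_le_tsum (fun i => hle _) (htail hs) ((htail hxs).add (htail hys))

/-- Uniform tightness of solutions of the forward equation. -/
theorem Admissible.exists_tail_le (h : Admissible ⊤ lam mu L M a b δ β) {K r B e : ℝ}
    (hr : 0 < r) (hK : 0 < K)
    (hexp : ∀ s t : ℝ, 0 ≤ s → s ≤ t →
      Real.exp (-∫ u in s..t, β u) ≤ K * Real.exp (-r * (t - s)))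
    (hB : ∀ t, 0 ≤ t → ∫ q in (0 : ℝ)..t, Real.exp (-r * (t - q)) * a q ≤ B)
    {p : ℝ → ℕ → ℝ} (hp : IsForwardSolution ⊤ lam mu a b 0 p) (he : 0 < e) :
    ∃ n₀, ∀ n ≥ n₀, ∀ t, 0 ≤ t → tail (p t) n ≤ 2 * e := by
  have hlt : ∀ k : ℕ, (k : ℕ∞) < ⊤ := ENat.natCast_lt_top
  have hw := weight_nonneg h.ratio_pos
  have hu := h.isTailSolution le_rfl hp
  obtain ⟨S, hS0, hS⟩ := exists_excessSum_le_of_tendsto_zero hw he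
    (tendsto_tail (hp.mem 0 le_rfl).2.2.summable)
  have hl0 := h.rates.lam_nonneg 0 (hlt 0).le
  have key : ∀ t, 0 ≤ t → ∀ m, excessSum (weight ⊤ δ) e (tail (p t)) m ≤
      K * S + lam 0 * (K * B) := fun t ht m => by
    have h1 := h.excessSum_mul_exp_le hu le_rfl ht he.le hS m
    rw [abs_one, mul_one, ← le_div_iff₀ (Real.exp_pos _), div_eq_inv_mul, ← Real.exp_neg,
      mul_add] at h1
    have hI : ∀ s s', 0 ≤ s → 0 ≤ s' → IntervalIntegrable
        (fun q => Real.exp (-r * (t - q)) * a q) volume s s' := fun s s' hs hs' =>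
      (h.integrable_a s s' hs hs').continuousOn_mul (by fun_prop)
    have h2 : Real.exp (-∫ r in (0 : ℝ)..t, β r) * S ≤ K * S := by
      refine mul_le_mul_of_nonneg_right ((hexp 0 t le_rfl ht).trans ?_) hS0
      refine mul_le_of_le_one_right hK.le (Real.exp_le_one_iff.2 ?_)
      nlinarith
    -- The two exponentials combine to exp(-∫_q^t β) ≤ K e^{-r(t-q)}, leaving the convolution
    -- bounded by B.
    have h3 : Real.exp (-∫ r in (0 : ℝ)..t, β r) *
        ∫ r in (0 : ℝ)..t, Real.exp (∫ q in (0 : ℝ)..r, β q) * a r ≤ K * B := by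
      rw [← intervalIntegral.integral_const_mul]
      have hcE : ContinuousOn (fun q => Real.exp (∫ p in (0 : ℝ)..q, β p)) (uIcc 0 t) :=
        (AbsolutelyContinuousOnInterval.exp ((h.integrable_β 0 t le_rfl ht
          ).absolutelyContinuousOnInterval_intervalIntegral left_mem_uIcc)).continuousOn
      refine le_trans (intervalIntegral.integral_mono_on ht
        (((h.integrable_a 0 t le_rfl ht).continuousOn_mul hcE).const_mul _)
        ((hI 0 t le_rfl ht).const_mul K) fun q hq => ?_) ?_
      · rw [← mul_assoc, ← mul_assoc, ← Real.exp_add]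
        refine mul_le_mul_of_nonneg_right ?_ (h.a_nonneg q hq.1)
        refine le_trans (le_of_eq ?_) (hexp q t hq.1 hq.2)
        congr 1
        have := intervalIntegral.integral_add_adjacent_intervals
          (h.integrable_β 0 q le_rfl hq.1) (h.integrable_β q t hq.1 ht)
        linarith
      · rw [intervalIntegral.integral_const_mul]
        exact mul_le_mul_of_nonneg_left (hB t ht) hK.le
    have h4 := mul_le_mul_of_nonneg_left h3 hl0
    linarith
  obtain ⟨n₀, hn₀⟩ := ((h.tendsto_weight rfl).eventually_ge_atTop
    ((K * S + lam 0 * (K * B)) / e)).exists_forall_of_atTop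
  refine ⟨n₀, fun n hn t ht => ?_⟩
  have h1 := (term_le_excessSum hw e (tail (p t)) le_rfl).trans (key t ht n)
  have h2 := hn₀ n hn
  rw [div_le_iff₀ he] at h2
  -- For large n the weight exceeds (uniform bound) / e, so the excess of the n-th tail over e is at
  -- most e.
  have h3 := le_of_mul_le_mul_left (h1.trans h2) (weight_pos h.ratio_pos n (hlt n))
  have h4 := abs_le_excess_add e (tail (p t) n)
  have h5 := le_abs_self (tail (p t) n)
  linarith

/-- With η = 0 there is no source and the excess sum decays to zero; weights bounded below by their
infimum turn this into a bound uniform in k. -/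
theorem Admissible.eventually_abs_tail_le (h : Admissible ⊤ lam mu L M a b δ β) {K r κ : ℝ}
    (hr : 0 < r)
    (hexp : ∀ s t : ℝ, 0 ≤ s → s ≤ t →
      Real.exp (-∫ u in s..t, β u) ≤ K * Real.exp (-r * (t - s)))
    {p₁ p₂ : ℝ → ℕ → ℝ} (h₁ : IsForwardSolution ⊤ lam mu a b 0 p₁)
    (h₂ : IsForwardSolution ⊤ lam mu a b 0 p₂) (hκ : 0 < κ) :
    ∀ᶠ t in atTop, ∀ k, |tail (p₁ t - p₂ t) k| ≤ 2 * κ := by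
  have hlt : ∀ k : ℕ, (k : ℕ∞) < ⊤ := ENat.natCast_lt_top
  have hw := weight_nonneg h.ratio_pos
  have hu := h.isTailSolution_sub le_rfl h₁ h₂
  have hg := h.weightInf_pos
  obtain ⟨S, hS0, hS⟩ := exists_excessSum_le_of_tendsto_zero hw hκ
    (tendsto_tail ((h₁.mem 0 le_rfl).2.2.summable.sub (h₂.mem 0 le_rfl).2.2.summable))
  have h1 : Tendsto (fun t : ℝ => K * Real.exp (-r * (t - 0)) * S) atTop (𝓝 0) := by
    have : Tendsto (fun t : ℝ => Real.exp (-r * (t - 0))) atTop (𝓝 0) := by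
      refine Real.tendsto_exp_atBot.comp ?_
      simp only [sub_zero]
      exact tendsto_id.const_mul_atTop_of_neg (neg_neg_of_pos hr)
    simpa using (this.const_mul K).mul_const S
  filter_upwards [h1.eventually (ge_mem_nhds (mul_pos hg hκ)), eventually_ge_atTop 0]
    with t ht ht0 k
  have h3 := h.excessSum_mul_exp_le hu le_rfl ht0 hκ.le hS k
  rw [abs_zero, mul_zero, zero_mul, add_zero, ← le_div_iff₀ (Real.exp_pos _), div_eq_inv_mul,
    ← Real.exp_neg] at h3
  have h4 := h3.trans (mul_le_mul_of_nonneg_right (hexp 0 t le_rfl ht0) hS0)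
  have h5 := (term_le_excessSum hw κ (tail (p₁ t - p₂ t)) (le_refl k)).trans (h4.trans ht)
  have h6 := (mul_le_mul_of_nonneg_right (weightInf_le h.ratio_pos k (hlt k))
    (excess_nonneg κ (tail (p₁ t - p₂ t) k))).trans h5
  have h7 := le_of_mul_le_mul_left h6 hg
  have h8 := abs_le_excess_add κ (tail (p₁ t - p₂ t) k)
  linarith

theorem Admissible.weaklyErgodic_of_top (h : Admissible ⊤ lam mu L M a b δ β) {K r B : ℝ}
    (hr : 0 < r) (hK : 0 < K)
    (hexp : ∀ s t : ℝ, 0 ≤ s → s ≤ t →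
      Real.exp (-∫ u in s..t, β u) ≤ K * Real.exp (-r * (t - s)))
    (hB : ∀ t, 0 ≤ t → ∫ q in (0 : ℝ)..t, Real.exp (-r * (t - q)) * a q ≤ B) :
    WeaklyErgodic ⊤ lam mu a b := by
  intro p₁ p₂ h₁ h₂
  rw [ENNReal.tendsto_nhds_zero]
  intro ε hε
  -- The budget 8e is 4e for the first n + 1 coordinates plus 2e for the tail of each solution.
  obtain ⟨e, he, hle⟩ : ∃ e : ℝ, 0 < e ∧ ENNReal.ofReal (8 * e) ≤ ε := by
    rcases eq_or_ne ε ⊤ with rfl | hne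
    · exact ⟨1, one_pos, le_top⟩
    · refine ⟨ε.toReal / 8, div_pos (ENNReal.toReal_pos hε.ne' hne) (by norm_num), ?_⟩
      rw [mul_div_cancel₀ _ (by norm_num), ENNReal.ofReal_toReal hne]
  obtain ⟨n₁, hn₁⟩ := h.exists_tail_le hr hK hexp hB h₁ he
  obtain ⟨n₂, hn₂⟩ := h.exists_tail_le hr hK hexp hB h₂ he
  set n := max n₁ n₂
  have hn : (0 : ℝ) < n + 1 := by positivity
  -- The level e / (n + 1) makes each of the n + 1 coordinates, a difference of two tails, at most
  -- 4e / (n + 1).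
  filter_upwards [h.eventually_abs_tail_le hr hexp h₁ h₂ (div_pos he hn), eventually_ge_atTop 0]
    with t ht ht0
  have m₁ := h₁.mem t ht0
  have m₂ := h₂.mem t ht0
  refine (norm1_sub_le_of_probVectors m₁ m₂ n).trans
    ((ENNReal.ofReal_le_ofReal ?_).trans hle)
  have h3 : ∀ i, |(p₁ t - p₂ t) i| ≤ 4 * (e / (n + 1)) := fun i => by
    have hs : HasSum (p₁ t - p₂ t) 0 := by
      have := m₁.2.2.sub m₂.2.2
      rwa [sub_self] at this
    have h4 := pre_tail_sub_tail hs.summable i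
    rw [hs.tsum_eq] at h4
    have h5 : |pre 0 (tail (p₁ t - p₂ t)) i| ≤ 2 * (e / (n + 1)) := by
      cases i with
      | zero => simp only [pre, abs_zero]; positivity
      | succ i => exact ht i
    rw [← h4]
    exact (abs_sub _ _).trans (by linarith [ht i])
  have h6 : ∑ i ∈ Finset.range (n + 1), |(p₁ t - p₂ t) i| ≤ 4 * e := by
    refine (Finset.sum_le_card_nsmul _ _ _ fun i _ => h3 i).trans (le_of_eq ?_)
    rw [Finset.card_range, nsmul_eq_mul]
    push_cast
    field_simp
  linarith [hn₁ n (le_max_left _ _) t ht0, hn₂ n (le_max_right _ _) t ht0]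

end Merging

/-! ### Long-time exponents and assembly of the theorem -/

/-- Supplies the lower bound without which the real infimum of the f_k would not be known to lie
below each f_k. -/
theorem f_nonneg {lam mu : ℕ → ℝ} {L M Δ : ℝ} (hD : 0 < Δ * L * M) {k : ℕ}
    (h : 0 ≤ prev lam k * mu (k + 1) - lam k * mu k) : 0 ≤ f lam mu L M Δ k := by
  refine div_nonneg ?_ (by linarith)
  have h1 : |Δ * L * mu (k + 1) - prev lam k * M| ≤
      √((Δ * L * mu (k + 1) - prev lam k * M) ^ 2
        + 4 * Δ * L * M * (prev lam k * mu (k + 1) - lam k * mu k)) :=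
    Real.abs_le_sqrt (by nlinarith [mul_nonneg hD.le h])
  linarith [neg_abs_le (Δ * L * mu (k + 1) - prev lam k * M)]

theorem exists_exp_neg_integral_le {a a₁ a₂ b b₁ b₂ : ℝ → ℝ} {T₁ T₂ c A B ε : ℝ}
    (ha : AsymptoticallyPeriodic a a₁ a₂ T₁) (hb : AsymptoticallyPeriodic b b₁ b₂ T₂)
    (hc : 0 < c) (hB : 0 < B) (hA : 0 < A) (hε : 0 < ε) :
    ∃ K : ℝ, 0 < K ∧ ∀ s t : ℝ, 0 ≤ s → s ≤ t →
      Real.exp (-∫ u in s..t, c * (B * b u - A * a u)) ≤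
        K * Real.exp (-(c * (B * periodMean b₁ T₂ - A * periodMean a₁ T₁) - ε) * (t - s)) := by
  -- The tolerances are chosen so that a and b each contribute ε / 2 to the exponent.
  obtain ⟨Ca, hCa⟩ := ha.abs_integral_sub_le (ε := ε / (2 * c * A)) (by positivity)
  obtain ⟨Cb, hCb⟩ := hb.abs_integral_sub_le (ε := ε / (2 * c * B)) (by positivity)
  refine ⟨Real.exp (c * (B * Cb + A * Ca)), Real.exp_pos _, fun s t hs hst => ?_⟩
  have ht := hs.trans hst
  rw [← Real.exp_add, Real.exp_le_exp, intervalIntegral.integral_const_mul,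
    intervalIntegral.integral_sub ((hb.intervalIntegrable hs ht).const_mul _)
      ((ha.intervalIntegrable hs ht).const_mul _),
    intervalIntegral.integral_const_mul, intervalIntegral.integral_const_mul]
  have h1 := mul_le_mul_of_nonneg_left (abs_le.1 (hCa s t hs hst)).2 (mul_pos hc hA).le
  have h2 := mul_le_mul_of_nonneg_left (abs_le.1 (hCb s t hs hst)).1 (mul_pos hc hB).le
  have e1 : c * A * (ε / (2 * c * A) * (t - s) + Ca) = ε / 2 * (t - s) + c * A * Ca := by
    field_simp
  have e2 : c * B * -(ε / (2 * c * B) * (t - s) + Cb) = -(ε / 2 * (t - s)) - c * B * Cb := by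
    field_simp
    ring
  rw [e1] at h1
  rw [e2] at h2
  linarith

end BDP

theorem mainTheorem5 (N : ℕ∞) (lam mu : ℕ → ℝ) (L M : ℝ) (hrates : BDP.Rates N lam mu L M)
    (a a₁ a₂ b b₁ b₂ : ℝ → ℝ) (T₁ T₂ : ℝ)
    (ha : BDP.AsymptoticallyPeriodic a a₁ a₂ T₁) (hb : BDP.AsymptoticallyPeriodic b b₁ b₂ T₂)
    (Δ : ℝ) (hΔ : 1 < Δ)
    (h_a : ∀ k : ℕ, (k : ℕ∞) < N → 0 ≤ BDP.prev lam k * mu (k + 1) - lam k * mu k)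
    (h_b : 0 < M * BDP.periodMean b₁ T₂ - Δ * L * BDP.periodMean a₁ T₁)
    (h_c : 0 < BDP.fInf N lam mu L M Δ)
    (c : ℝ) (hc0 : 0 < c) (hc1 : c < 1)
    (hcmu : ∀ k : ℕ, (k : ℕ∞) < N → c < mu (k + 1) / M)
    (hcf : c ≤ BDP.fInf N lam mu L M Δ)
    (lt : ℝ → ℝ) (hlt : ∀ t, lt t = c * (M * b t - Δ * L * a t))
    (l : ℝ) (hl : l = c * (M * BDP.periodMean b₁ T₂ - Δ * L * BDP.periodMean a₁ T₁)) :
    0 < l ∧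
    BDP.WeaklyErgodic N lam mu a b ∧
    ∃ δ : ℕ → ℝ,
      (∀ k : ℕ, (k : ℕ∞) < N → 0 < δ k) ∧
      (N = ⊤ → 1 < liminf (fun k => ((δ k : ℝ) : EReal)) atTop) ∧
      (∀ t : ℝ, 0 ≤ t → ∀ k : ℕ, (k : ℕ∞) < N → lt t ≤ BDP.alpha lam mu a b δ k t) ∧
      0 < BDP.weightInf N δ ∧
      ∀ ε : ℝ, 0 < ε → ∃ K : ℝ,
        (∀ s t : ℝ, 0 ≤ s → s ≤ t →
          Real.exp (-∫ u in s..t, lt u) ≤ K * Real.exp (-(l - ε) * (t - s))) ∧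
        BDP.ExponentialMerging N lam mu a b δ K (l - ε) := by
  have hL := hrates.L_pos
  have hM := hrates.M_pos
  have hΔ0 : 0 < Δ := zero_lt_one.trans hΔ
  have he : 0 < c * Δ * L := by positivity
  have hl0 : 0 < l := hl ▸ mul_pos hc0 h_b
  have hltf : lt = fun t => c * (M * b t - Δ * L * a t) := funext hlt
  have hai : ∀ s t, 0 ≤ s → 0 ≤ t → IntervalIntegrable a volume s t := fun s t =>
    ha.intervalIntegrable
  have hbi : ∀ s t, 0 ≤ s → 0 ≤ t → IntervalIntegrable b volume s t := fun s t =>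
    hb.intervalIntegrable
  have hf : ∀ k : ℕ, (k : ℕ∞) < N → c ≤ BDP.f lam mu L M Δ k := fun k hk => by
    refine hcf.trans (csInf_le ⟨0, ?_⟩ (mem_image_of_mem _ hk))
    rintro _ ⟨j, hj, rfl⟩
    exact BDP.f_nonneg (by positivity) (h_a j hj)
  have hadm : BDP.Admissible N lam mu L M a b (BDP.ratio lam (c * Δ * L)) lt :=
    { rates := hrates
      integrable_a := hai
      integrable_b := hbi
      integrable_β := fun s t hs ht => by
        rw [hltf]
        exact (((hbi s t hs ht).const_mul M).sub ((hai s t hs ht).const_mul (Δ * L))).const_mul c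
      a_nonneg := ha.nonneg
      b_nonneg := hb.nonneg
      ratio_pos := hrates.ratio_pos he
      tendsto_ratio := fun hN => by
        subst hN
        -- The limit of the ratios is (L + cΔL) / L = 1 + cΔ.
        exact ⟨_, (one_lt_div hL).2 (by linarith), hrates.tendsto_ratio _⟩
      le_alpha := fun t ht k hk => by
        rw [hlt]
        exact hrates.le_alpha hΔ0 hc0 hk (ha.nonneg t ht) (hb.nonneg t ht) (h_a k hk)
          (hcmu k hk) (hf k hk) }
  have hexp : ∀ ε : ℝ, 0 < ε → ∃ K : ℝ, 0 < K ∧ ∀ s t : ℝ, 0 ≤ s → s ≤ t →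
      Real.exp (-∫ u in s..t, lt u) ≤ K * Real.exp (-(l - ε) * (t - s)) := fun ε hε => by
    rw [hltf, hl]
    exact BDP.exists_exp_neg_integral_le ha hb hc0 hM (mul_pos hΔ0 hL) hε
  have hmerge : ∀ ε : ℝ, 0 < ε → ∃ K : ℝ, (∀ s t : ℝ, 0 ≤ s → s ≤ t →
      Real.exp (-∫ u in s..t, lt u) ≤ K * Real.exp (-(l - ε) * (t - s))) ∧
      BDP.ExponentialMerging N lam mu a b (BDP.ratio lam (c * Δ * L)) K (l - ε) :=
    fun ε hε => by
      obtain ⟨K, hK, h⟩ := hexp ε hε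
      exact ⟨K, h, hadm.exponentialMerging hK h⟩
  refine ⟨hl0, ?_, BDP.ratio lam (c * Δ * L), hadm.ratio_pos, fun hN => ?_, hadm.le_alpha,
    hadm.weightInf_pos, hmerge⟩
  · rcases BDP.cases_of_one_le hrates.one_le with rfl | ⟨n, rfl⟩
    · obtain ⟨K, hK, h⟩ := hexp (l / 2) (half_pos hl0)
      obtain ⟨C, hC⟩ := ha.abs_integral_sub_le one_pos
      have hr : 0 < l - l / 2 := by linarith
      -- The value of A bounds ∫ a over unit intervals, by the averaging estimate with tolerance 1.
      refine hadm.weaklyErgodic_of_top hr hK h fun t ht =>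
        BDP.integral_exp_mul_le (A := BDP.periodMean a₁ T₁ + 1 + C) hr hai ha.nonneg
          (fun s hs => ?_) ht
      have h1 := (abs_le.1 (hC s (s + 1) hs (by linarith))).2
      rw [add_sub_cancel_left] at h1
      linarith
    · obtain ⟨K, -, hK⟩ := hmerge (l / 2) (half_pos hl0)
      exact BDP.weaklyErgodic_of_exponentialMerging (by linarith) hK
  · obtain ⟨ρ, hρ, hlim⟩ := hadm.tendsto_ratio hN
    have h1 : Tendsto (fun k => ((BDP.ratio lam (c * Δ * L) k : ℝ) : EReal)) atTop
        (𝓝 (ρ : EReal)) := (continuous_coe_real_ereal.tendsto ρ).comp hlim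
    rw [h1.liminf_eq]
    exact_mod_cast hρ
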